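/- **Setting.** All graphs are finite DAGs with vertices labelled by natural numbers. Two DAGs $G,H$ on the same vertices are *Markov equivalent* if the same joint distributions of (real-valued) variables $(X_v)$ at the vertices are Markov with respect to $G$ and to $H$ (each $X_v$ is conditionally independent of its non-descendants given its parents). For a finite set $J$ of single-node interventions, $G$ and $H$ are *$J$-Markov equivalent* if $G,H$ are Markov equivalent and $G^{(v)},H^{(v)}$ are Markov equivalent for all $v\in J$, where $G^{(v)}$ is $G$ without the edges into $v$ (labels in $J$ that are not vertices have no effect). The *essential graph* $J(G)=\mathrm{Ess}(G,J)$ has the skeleton of $G$; an edge is directed if it has the same orientation in all DAGs that are $J$-Markov equivalent to $G$, and undirected otherwise. Let $G'$ be the subgraph of $G$ induced by all vertices $v$ such that neither $v$ nor any descendant of $v$ has an undirected edge of $\mathrm{Ess}(G,\emptyset)$ at it. An *algorithm* $A$ chooses, for each number $r$ and each DAG $G$, a set $A_r(G)$ of at most $r$ single-node interventions (it may, for instance, use only the essential graph of $G$). $A$ is *downstream-independent* if the interventions it performs on $G$ are identical to the ones it performs on $G\setminus G'$ (on $G\setminus G'$, interventions on other nodes being skipped), for all $G$ and $r$. Let $Y(r,A)(G)$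 be the number of undirected edges of $\mathrm{Ess}(G,A_r(G))$. Let $0\le\rho\le1$. A *random order DAG* $G_n\sim\mathrm{orderDAG}(n,\rho)$ is an Erdős–Rényi graph with edge probability $\rho$ on $n$ labelled vertices, with the edges oriented along an independent, uniformly random total order of the vertices. In its *sorted form* the vertices $v_1,\dots,v_n$ are named along the order, so that the edges $v_j\to v_k$, $j<k$, are present independently with probability $\rho$. Write $Y(r,A)_n=Y(r,A)(G_n)$. **Theorem.** Let $A$ be a downstream-independent algorithm. For all integers $r,i\ge 0$, $$\bigl|\mathbb E\,Y(r,A)_{i+1}-\mathbb E\,Y(r,A)_i\bigr|\;\le\;\rho\, i\,\bigl(1-\rho(1-\rho)\bigr)^{i-1}\cdot\frac{i(i+1)}2$$ (the right-hand side being $0$ for $i=0$), in both of the following cases: 1. the random order DAGs $G_i$, $G_{i+1}$ are in sorted form; 2. $G_i\sim\mathrm{orderDAG}(i,\rho)$ and $G_{i+1}\sim\mathrm{orderDAG}(i+1,\rho)$ have uniformly random total orders, and $A$ depends on the vertex labels only through their relative order, that is, on vertices of the graph the chosen interventions commute with every order-preserving renaming of the vertices. -/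

import Mathlib

/-- A finite directed acyclic graph whose vertices are labelled by natural numbers.
The pair `(i, j)` is in `edges` when there is a directed edge `i → j`. -/
@[ext]
structure CausalDAG where
  verts : Finset ℕ
  edges : Finset (ℕ × ℕ)
  edges_subset : edges ⊆ verts ×ˢ verts
  acyclic : ∀ v, ¬ Relation.TransGen (fun i j => (i, j) ∈ edges) v v

namespace CausalDAG

open MeasureTheory ProbabilityTheory

/-- Parents of `v`. -/
def parents (G : CausalDAG) (v : ℕ) : Finset ℕ :=
  G.verts.filter fun u => (u, v) ∈ G.edges

/-- `w` is `v` itself or a descendant of `v`. -/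
def Reaches (G : CausalDAG) (v w : ℕ) : Prop :=
  Relation.ReflTransGen (fun i j => (i, j) ∈ G.edges) v w

open Classical in
/-- Non-descendants of `v`: the vertices other than `v` that cannot be reached from `v`. -/
noncomputable def nonDescendants (G : CausalDAG) (v : ℕ) : Finset ℕ :=
  G.verts.filter fun u => ¬ G.Reaches v u

/-- Passing to a subset of the edges (on a vertex set that contains their endpoints). -/
def restrict (G : CausalDAG) (V : Finset ℕ) (E : Finset (ℕ × ℕ)) (hE : E ⊆ G.edges)
    (hV : E ⊆ V ×ˢ V) : CausalDAG where
  verts := V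
  edges := E
  edges_subset := hV
  acyclic v h := G.acyclic v (Relation.TransGen.mono (fun _ _ hab => hE hab) _ _ h)

/-- The graph `G ∖ S`: the vertices in `S` are deleted with all edges at them. -/
def deleteVerts (G : CausalDAG) (S : Finset ℕ) : CausalDAG :=
  G.restrict (G.verts \ S) (G.edges.filter fun e => e.1 ∉ S ∧ e.2 ∉ S)
    (Finset.filter_subset _ _) (fun e he => by
      have h := Finset.mem_filter.1 he
      have h2 := Finset.mem_product.1 (G.edges_subset h.1)
      exact Finset.mem_product.2
        ⟨Finset.mem_sdiff.2 ⟨h2.1, h.2.1⟩, Finset.mem_sdiff.2 ⟨h2.2, h.2.2⟩⟩)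

/-- The intervened graph `G^(v)`: all edges into `v` are deleted. -/
def intervene (G : CausalDAG) (v : ℕ) : CausalDAG :=
  G.restrict G.verts (G.edges.filter fun e => e.2 ≠ v)
    (Finset.filter_subset _ _) ((Finset.filter_subset _ _).trans G.edges_subset)

/-- The graph obtained by renaming every vertex `v` to `f v`. -/
def relabel (G : CausalDAG) (f : ℕ ↪ ℕ) : CausalDAG where
  verts := G.verts.map f
  edges := G.edges.map (f.prodMap f)
  edges_subset e he := by
    obtain ⟨p, hp, rfl⟩ := Finset.mem_map.1 he
    have h := Finset.mem_product.1 (G.edges_subset hp)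
    exact Finset.mem_product.2
      ⟨Finset.mem_map_of_mem f h.1, Finset.mem_map_of_mem f h.2⟩
  acyclic v h := by
    refine G.acyclic (Function.invFun f v)
      (Relation.TransGen.lift (Function.invFun f) (fun a b hab => ?_) _ _ h)
    obtain ⟨⟨p, q⟩, hp, hpq⟩ := Finset.mem_map.1 hab
    obtain ⟨rfl, rfl⟩ := Prod.mk.inj hpq
    simpa [Function.onFun, Function.leftInverse_invFun f.injective p,
      Function.leftInverse_invFun f.injective q] using hp

/-- The joint distribution under `μ` of the real random variables `(X v)`, `v` a vertex of `G`,
is Markov with respect to `G`: every `X v` is conditionally independent of its non-descendants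
given its parents. -/
def IsMarkov (G : CausalDAG) {Ω : Type} [MeasurableSpace Ω] [StandardBorelSpace Ω]
    (μ : Measure Ω) [IsProbabilityMeasure μ] (X : ℕ → Ω → ℝ) (hX : ∀ v, Measurable (X v)) :
    Prop :=
  ∀ v ∈ G.verts,
    CondIndepFun
      (MeasurableSpace.comap (fun ω (u : G.parents v) => X u ω) inferInstance)
      (measurable_pi_lambda (fun ω (u : G.parents v) => X u ω) fun u => hX u).comap_le
      (X v) (fun ω (u : G.nonDescendants v) => X u ω) μ

/-- Markov equivalence: `G` and `H` have the same vertices, and the same joint distributions of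
the variables at the vertices are Markov with respect to `G` and to `H`. A joint distribution is
given through random variables on an arbitrary standard Borel probability space. -/
def MarkovEquiv (G H : CausalDAG) : Prop :=
  G.verts = H.verts ∧
    ∀ (Ω : Type) [MeasurableSpace Ω] [StandardBorelSpace Ω] (μ : Measure Ω)
      [IsProbabilityMeasure μ] (X : ℕ → Ω → ℝ) (hX : ∀ v, Measurable (X v)),
      G.IsMarkov μ X hX ↔ H.IsMarkov μ X hX

/-- Interventional Markov equivalence for single node interventions at the nodes of `J`, next to
the observational distribution: `G` and `H` are Markov equivalent, and so are `G^(v)` and `H^(v)`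
for all `v ∈ J`. A label in `J` that is not a vertex has no effect. -/
def IMarkovEquiv (J : Finset ℕ) (G H : CausalDAG) : Prop :=
  MarkovEquiv G H ∧ ∀ v ∈ J, MarkovEquiv (G.intervene v) (H.intervene v)

end CausalDAG

/-- A partially directed graph. -/
structure PartiallyDirectedGraph where
  verts : Finset ℕ
  directed : Finset (ℕ × ℕ)
  undirected : Finset (Sym2 ℕ)

namespace CausalDAG

open Classical in
/-- The essential graph `J(G) = Ess(G, J)`: it has the skeleton of `G`, an edge of `G` is directed
when it has the same orientation in all members of the interventional Markov equivalence class
of `G`, and all other edges are undirected. -/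
noncomputable def essentialGraph (G : CausalDAG) (J : Finset ℕ) : PartiallyDirectedGraph where
  verts := G.verts
  directed := G.edges.filter fun e => ∀ H, IMarkovEquiv J G H → e ∈ H.edges
  undirected :=
    (G.edges.filter fun e => ¬ ∀ H, IMarkovEquiv J G H → e ∈ H.edges).image fun e => s(e.1, e.2)

open Classical in
/-- The vertices `v` such that neither `v` nor any descendant of `v` has an undirected edge of the
observational essential graph at it. They induce the subgraph `G'` of `G`. -/
noncomputable def downstream (G : CausalDAG) : Finset ℕ :=
  G.verts.filter fun v => ∀ w, G.Reaches v w → ∀ e ∈ (G.essentialGraph ∅).undirected, w ∉ e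

/-- The graph `G ∖ G'`. -/
noncomputable def core (G : CausalDAG) : CausalDAG := G.deleteVerts G.downstream

end CausalDAG

/-- An algorithm that, for every number `r`, performs (at most) `r` single node interventions.
The set of interventions may be any function of the causal DAG; this includes the algorithms that
only see its essential graph, and the sequential ones that also see what the earlier interventions
reveal. A label that is not a vertex is an intervention that is skipped. -/
structure InterventionAlgorithm where
  select : ℕ → CausalDAG → Finset ℕ
  card_select_le : ∀ r G, (select r G).card ≤ r

namespace InterventionAlgorithm

/-- The interventions performed on `G` are identical to the ones performed on `G ∖ G'`, where, on
`G ∖ G'`, interventions on other nodes are skipped. -/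
def DownstreamIndependent (A : InterventionAlgorithm) : Prop :=
  ∀ r G, A.select r G ∩ G.core.verts = A.select r G.core ∩ G.core.verts

/-- The interventions depend on the vertex labels only through their relative order: the algorithm
commutes with every order-preserving renaming of the vertices. -/
def LabelInvariant (A : InterventionAlgorithm) : Prop :=
  ∀ r G (f : ℕ ↪o ℕ),
    A.select r (G.relabel f.toEmbedding) ∩ (G.relabel f.toEmbedding).verts =
      (A.select r G ∩ G.verts).map f.toEmbedding

/-- The number of undirected edges of the essential graph after `r` interventions on `G` that are
chosen by `A`. -/
noncomputable def undirectedCount (A : InterventionAlgorithm) (r : ℕ) (G : CausalDAG) : ℕ :=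
  (G.essentialGraph (A.select r G)).undirected.card

end InterventionAlgorithm

namespace CausalDAG

open MeasureTheory

open Classical in
/-- The graph `S` on the vertices `0, …, n - 1`, with its edges oriented along the total order in
which the vertex `v` has position `π v`. -/
noncomputable def orient {n : ℕ} (S : SimpleGraph (Fin n)) (π : Equiv.Perm (Fin n)) :
    CausalDAG where
  verts := Finset.range n
  edges := ((Finset.univ : Finset (Fin n × Fin n)).filter
    fun e => S.Adj e.1 e.2 ∧ π e.1 < π e.2).image fun e => ((e.1 : ℕ), (e.2 : ℕ))
  edges_subset e he := by
    obtain ⟨p, -, rfl⟩ := Finset.mem_image.1 he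
    simp
  acyclic v h := by
    have key : ∀ a b : ℕ, Relation.TransGen (fun i j => (i, j) ∈
        ((Finset.univ : Finset (Fin n × Fin n)).filter
          fun e => S.Adj e.1 e.2 ∧ π e.1 < π e.2).image fun e => ((e.1 : ℕ), (e.2 : ℕ))) a b →
        ∃ x y : Fin n, (x : ℕ) = a ∧ (y : ℕ) = b ∧ π x < π y := by
      intro a b hab
      induction hab with
      | single h1 =>
        obtain ⟨p, hp, hpe⟩ := Finset.mem_image.1 h1
        obtain ⟨h2, h3⟩ := Prod.mk.inj hpe
        exact ⟨p.1, p.2, h2, h3, (Finset.mem_filter.1 hp).2.2⟩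
      | tail _ h1 ih =>
        obtain ⟨x, y, hx, hy, hxy⟩ := ih
        obtain ⟨p, hp, hpe⟩ := Finset.mem_image.1 h1
        obtain ⟨h2, h3⟩ := Prod.mk.inj hpe
        have h4 : y = p.1 := Fin.ext (hy.trans h2.symm)
        exact ⟨x, p.2, hx, h3, hxy.trans (h4 ▸ (Finset.mem_filter.1 hp).2.2)⟩
    obtain ⟨x, y, hx, hy, hxy⟩ := key v v h
    have h5 : x = y := Fin.ext (hx.trans hy.symm)
    exact absurd hxy (h5 ▸ lt_irrefl _)

instance : MeasurableSpace CausalDAG := ⊤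

/-- The law `orderDAG(n, ρ)`: the skeleton is an Erdős–Rényi graph with edge probability `ρ`, and,
independently, the total order is uniform among all `n!` permutations. -/
noncomputable def orderDAG (n : ℕ) (ρ : unitInterval) : Measure CausalDAG :=
  ∑ π : Equiv.Perm (Fin n), ((n.factorial : ENNReal)⁻¹) •
    (SimpleGraph.binomialRandom (Fin n) ρ).map fun S => orient S π

/-- The law of the random order DAG with its vertices named along the total order: independently
for all `i < j`, there is an edge `i → j` with probability `ρ`. -/
noncomputable def sortedOrderDAG (n : ℕ) (ρ : unitInterval) : Measure CausalDAG :=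
  (SimpleGraph.binomialRandom (Fin n) ρ).map fun S => orient S 1

end CausalDAG

/-! Couple the two random graphs: the smaller one is the larger one without the last vertex `v` of
the order. Suppose that every parent `a` of `v` has another parent `b` of `v` not adjacent to it.
Then `v` is a sink all of whose edges lie in v-structures (`IsShieldedSink`), and deleting it
changes neither the undirected edges of an essential graph, for any set of interventions, nor the
core `G ∖ G'`. A downstream-independent algorithm makes the same choices on the core, and
interventions elsewhere have no effect, so the two counts agree
(`DownstreamIndependent.undirectedCount_deleteVerts`).

The exceptional event is that some neighbour `j` of `v` is adjacent to all other neighbours. For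
fixed `j`, independence of the edges gives probability `ρ (1 - ρ(1-ρ))^(i-1)`: the edge `j v` is
present, and none of the other `i - 1` vertices is joined to `v` but not to `j`. A union bound over
`j` contributes the factor `i`. On this event both counts lie between `0` and `(i+1).choose 2`,
which gives the last factor.

Since Markov equivalence is defined by distributions, the graph theory has to be derived from it.
Equality of skeletons and preservation of v-structures, the only consequences needed, follow from
one test distribution: a fair coin shown at a few vertices, zero elsewhere. The effect of deleting a
sink, and of intervening at a vertex whose parents agree in both graphs, comes from a factorisation
of the Markov property over sinks (`IsSink.isMarkov_iff`, `isMarkov_intervene_iff`). -/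

open MeasureTheory ProbabilityTheory

/-! ### Conditional independence in terms of conditional probabilities -/

section CondIndep

variable {Ω : Type*} {m' m₁ m₂ mΩ : MeasurableSpace Ω} [StandardBorelSpace Ω]
  {μ : Measure Ω} [IsProbabilityMeasure μ]

/-- Conditional independence of `m₁` and `m₂` given `m'`, in terms of the conditional
probabilities of the events of `m₁`. -/
theorem condIndep_iff_condExp_sup_eq (hm' : m' ≤ mΩ) (hm₁ : m₁ ≤ mΩ) (hm₂ : m₂ ≤ mΩ) :
    CondIndep m' m₁ m₂ hm' μ ↔
      ∀ t, MeasurableSet[m₁] t → μ⟦t | m₂ ⊔ m'⟧ =ᵐ[μ] μ⟦t | m'⟧ := by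
  have hsup : m₂ ⊔ m' ≤ mΩ := sup_le hm₂ hm'
  have hind : ∀ t, MeasurableSet[mΩ] t → Integrable (t.indicator fun _ : Ω => (1 : ℝ)) μ :=
    fun t ht => (integrable_const 1).indicator ht
  have hmul : ∀ (t a : Set Ω), (fun ω => a.indicator (fun _ => (1 : ℝ)) ω *
      t.indicator (fun _ => (1 : ℝ)) ω) = (t ∩ a).indicator fun _ => (1 : ℝ) := by
    intro t a
    ext ω
    by_cases h1 : ω ∈ a <;> by_cases h2 : ω ∈ t <;> simp [h1, h2]
  -- the conditional probability of `a` times that of `t`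
  have hpull : ∀ t a, MeasurableSet[mΩ] t → MeasurableSet[mΩ] a →
      μ[fun ω => a.indicator (fun _ => (1 : ℝ)) ω * (μ⟦t | m'⟧) ω | m'] =ᵐ[μ]
        fun ω => (μ⟦t | m'⟧) ω * (μ⟦a | m'⟧) ω := by
    intro t a ht ha
    have h := condExp_mul_of_stronglyMeasurable_right (m := m') (μ := μ)
      (f := a.indicator fun _ => (1 : ℝ)) (g := μ⟦t | m'⟧) stronglyMeasurable_condExp
      (by
        have := (integrable_condExp (μ := μ) (m := m')
          (f := t.indicator fun _ => (1 : ℝ))).indicator ha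
        refine this.congr (Filter.Eventually.of_forall fun ω => ?_)
        by_cases h1 : ω ∈ a <;> simp [h1])
      (hind a ha)
    filter_upwards [h] with ω hω
    have : (μ[fun ω => a.indicator (fun _ => (1 : ℝ)) ω * (μ⟦t | m'⟧) ω | m']) ω =
      (μ[(a.indicator fun _ => (1 : ℝ)) * μ⟦t | m'⟧ | m']) ω := rfl
    rw [this, hω, Pi.mul_apply, mul_comm]
  rw [condIndep_iff m' m₁ m₂ hm' hm₁ hm₂]
  constructor
  · intro h t ht
    have ht' := hm₁ t ht
    symm
    refine ae_eq_condExp_of_forall_setIntegral_eq hsup (hind t ht')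
      (fun s _ _ => integrable_condExp.integrableOn) ?_
      ⟨_, (stronglyMeasurable_condExp (m := m')).mono le_sup_right, ae_eq_rfl⟩
    intro s hs _
    -- The set integrals of both functions agree on a generating π-system, namely the intersections
    -- of an event of `m₂` with one of `m'`, and then on the whole σ-algebra by Dynkin's argument.
    have hgen : m₂ ⊔ m' = MeasurableSpace.generateFrom
        (Set.image2 (· ∩ ·) {a | MeasurableSet[m₂] a} {b | MeasurableSet[m'] b}) := by
      apply le_antisymm
      · refine sup_le (fun a ha => ?_) (fun b hb => ?_)
        · exact MeasurableSpace.measurableSet_generateFrom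
            ⟨a, ha, Set.univ, MeasurableSet.univ, Set.inter_univ a⟩
        · exact MeasurableSpace.measurableSet_generateFrom
            ⟨Set.univ, MeasurableSet.univ, b, hb, Set.univ_inter b⟩
      · refine MeasurableSpace.generateFrom_le ?_
        rintro _ ⟨a, ha, b, hb, rfl⟩
        exact MeasurableSet.inter (le_sup_left (b := m') a ha) (le_sup_right (a := m₂) b hb)
    have hpi : IsPiSystem
        (Set.image2 (· ∩ ·) {a | MeasurableSet[m₂] a} {b | MeasurableSet[m'] b}) := by
      rintro _ ⟨a, ha, b, hb, rfl⟩ _ ⟨c, hc, d, hd, rfl⟩ -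
      exact ⟨a ∩ c, MeasurableSet.inter ha hc, b ∩ d, MeasurableSet.inter hb hd,
        Set.inter_inter_inter_comm a c b d⟩
    induction s, hs using MeasurableSpace.induction_on_inter hgen hpi with
    | empty => simp
    | basic s hs =>
      obtain ⟨a, ha, b, hb, rfl⟩ := hs
      have ha' := hm₂ a ha
      have hb' := hm' b hb
      have e1 : ∀ g : Ω → ℝ, ∫ ω in a ∩ b, g ω ∂μ =
          ∫ ω in b, a.indicator (fun _ => (1 : ℝ)) ω * g ω ∂μ := by
        intro g
        rw [Set.inter_comm, ← setIntegral_indicator ha']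
        refine integral_congr_ae (Filter.Eventually.of_forall fun ω => ?_)
        by_cases h1 : ω ∈ a <;> simp [h1]
      have hint : Integrable
          (fun ω => a.indicator (fun _ => (1 : ℝ)) ω * (μ⟦t | m'⟧) ω) μ := by
        refine ((integrable_condExp (μ := μ) (m := m')
          (f := t.indicator fun _ => (1 : ℝ))).indicator ha').congr
          (Filter.Eventually.of_forall fun ω => ?_)
        by_cases h1 : ω ∈ a <;> simp [h1]
      rw [e1, e1, hmul, ← setIntegral_condExp hm' hint hb,
        ← setIntegral_condExp hm' (hind _ (ht'.inter ha')) hb]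
      refine integral_congr_ae (ae_restrict_of_ae ?_)
      filter_upwards [hpull t a ht' ha', h t a ht ha] with ω h1 h2
      rw [h1, h2, Pi.mul_apply]
    | compl s hs ih =>
      have h1 := integral_add_compl (hsup s hs) (integrable_condExp (μ := μ) (m := m')
          (f := t.indicator fun _ => (1 : ℝ)))
      have h2 := integral_add_compl (hsup s hs) (hind t ht')
      have h3 := integral_condExp hm' (μ := μ) (f := t.indicator fun _ => (1 : ℝ))
      have h4 := ih (measure_lt_top _ _)
      linarith
    | iUnion f hd hf ih =>
      rw [integral_iUnion (fun i => hsup _ (hf i)) hd integrable_condExp.integrableOn,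
        integral_iUnion (fun i => hsup _ (hf i)) hd (hind t ht').integrableOn]
      exact tsum_congr fun i => ih i (measure_lt_top _ _)
  · intro h t a ht ha
    have ht' := hm₁ t ht
    have ha' := hm₂ a ha
    have h1 : μ⟦t ∩ a | m₂ ⊔ m'⟧ =ᵐ[μ]
        fun ω => a.indicator (fun _ => (1 : ℝ)) ω * (μ⟦t | m'⟧) ω := by
      have h2 := condExp_mul_of_stronglyMeasurable_left (m := m₂ ⊔ m') (μ := μ)
        (f := a.indicator fun _ => (1 : ℝ)) (g := t.indicator fun _ => (1 : ℝ))
        (StronglyMeasurable.indicator stronglyMeasurable_const (le_sup_left (b := m') a ha))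
        (by
          have := hind _ (ht'.inter ha')
          rw [← hmul] at this
          exact this) (hind t ht')
      have h3 : (a.indicator fun _ => (1 : ℝ)) * (t.indicator fun _ => (1 : ℝ)) =
        (t ∩ a).indicator fun _ => (1 : ℝ) := hmul t a
      rw [h3] at h2
      filter_upwards [h2, h t ht] with ω h4 h5
      rw [h4, Pi.mul_apply, h5]
    have h2 := condExp_condExp_of_le (μ := μ) (f := (t ∩ a).indicator fun _ => (1 : ℝ))
      (le_sup_right (a := m₂) (b := m')) hsup
    have h3 := condExp_congr_ae (m := m') h1
    filter_upwards [h2, h3, hpull t a ht' ha'] with ω h4 h5 h6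
    rw [← h4, h5, h6, Pi.mul_apply]

end CondIndep

namespace CausalDAG

/-! ### Calculus of conditional independence for families of variables -/

section Families

variable {Ω : Type}

/-- The σ-algebra generated by the variables `X u`, `u ∈ S`. -/
@[reducible]
def sigmaOf (X : ℕ → Ω → ℝ) (S : Finset ℕ) : MeasurableSpace Ω :=
  ⨆ u ∈ S, MeasurableSpace.comap (X u) inferInstance

theorem comap_family_eq_sigmaOf (X : ℕ → Ω → ℝ) (S : Finset ℕ) :
    MeasurableSpace.comap (fun ω (u : S) => X u ω) inferInstance = sigmaOf X S := by
  rw [sigmaOf, MeasurableSpace.pi, MeasurableSpace.comap_iSup, iSup_subtype']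
  refine iSup_congr fun u => ?_
  rw [MeasurableSpace.comap_comp]
  rfl

theorem sigmaOf_mono (X : ℕ → Ω → ℝ) {S T : Finset ℕ} (h : S ⊆ T) : sigmaOf X S ≤ sigmaOf X T :=
  biSup_mono fun _ hu => h hu

theorem sigmaOf_union (X : ℕ → Ω → ℝ) (S T : Finset ℕ) :
    sigmaOf X (S ∪ T) = sigmaOf X S ⊔ sigmaOf X T :=
  Finset.iSup_union

@[simp]
theorem sigmaOf_singleton (X : ℕ → Ω → ℝ) (v : ℕ) :
    sigmaOf X {v} = MeasurableSpace.comap (X v) inferInstance := by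
  simp [sigmaOf]

theorem sigmaOf_congr {X Y : ℕ → Ω → ℝ} {S : Finset ℕ} (h : ∀ u ∈ S, X u = Y u) :
    sigmaOf X S = sigmaOf Y S :=
  iSup_congr fun u => iSup_congr fun hu => by rw [h u hu]

theorem sigmaOf_map (X : ℕ → Ω → ℝ) (S : Finset ℕ) (f : ℕ ↪ ℕ) :
    sigmaOf X (S.map f) = sigmaOf (fun u => X (f u)) S := by
  refine le_antisymm (iSup₂_le fun v hv => ?_) (iSup₂_le fun u hu => ?_)
  · obtain ⟨u, hu, rfl⟩ := Finset.mem_map.1 hv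
    exact le_iSup₂_of_le u hu le_rfl
  · exact le_iSup₂_of_le (f u) (Finset.mem_map_of_mem f hu) le_rfl

variable [mΩ : MeasurableSpace Ω]

theorem sigmaOf_le {X : ℕ → Ω → ℝ} (hX : ∀ v, Measurable (X v)) (S : Finset ℕ) :
    sigmaOf X S ≤ mΩ :=
  iSup₂_le fun u _ => (hX u).comap_le

/-- The families `(X u)`, `u ∈ A`, and `(X u)`, `u ∈ B`, are conditionally independent given
`(X u)`, `u ∈ C`: the conditional probabilities of the events of the first family given the other
two do not depend on the second. -/
def CI (μ : Measure Ω) (X : ℕ → Ω → ℝ) (A B C : Finset ℕ) : Prop :=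
  ∀ t, MeasurableSet[sigmaOf X A] t → μ⟦t | sigmaOf X (B ∪ C)⟧ =ᵐ[μ] μ⟦t | sigmaOf X C⟧

variable {μ : Measure Ω} {X : ℕ → Ω → ℝ} {A B B' C C' D : Finset ℕ}

theorem ci_congr {Y : ℕ → Ω → ℝ} (hA : ∀ u ∈ A, X u = Y u) (hB : ∀ u ∈ B, X u = Y u)
    (hC : ∀ u ∈ C, X u = Y u) : CI μ X A B C ↔ CI μ Y A B C := by
  rw [CI, CI, sigmaOf_union, sigmaOf_union, sigmaOf_congr hA, sigmaOf_congr hB, sigmaOf_congr hC]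

theorem ci_map (f : ℕ ↪ ℕ) :
    CI μ X (A.map f) (B.map f) (C.map f) ↔ CI μ (fun u => X (f u)) A B C := by
  rw [CI, CI, sigmaOf_union, sigmaOf_union, sigmaOf_map, sigmaOf_map, sigmaOf_map]

variable [IsProbabilityMeasure μ]

theorem ci_iff_condIndep [StandardBorelSpace Ω] (hX : ∀ v, Measurable (X v)) :
    CI μ X A B C ↔ CondIndep (sigmaOf X C) (sigmaOf X A) (sigmaOf X B) (sigmaOf_le hX C) μ := by
  rw [condIndep_iff_condExp_sup_eq _ (sigmaOf_le hX A) (sigmaOf_le hX B), CI, sigmaOf_union]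

theorem CI.symm [StandardBorelSpace Ω] (hX : ∀ v, Measurable (X v)) (h : CI μ X A B C) :
    CI μ X B A C := by
  rw [ci_iff_condIndep hX] at h ⊢
  exact CondIndep.symm h

/-- Tower property: condition the identity for the larger σ-algebra on the intermediate one, for
which the right-hand side is already measurable. Weak union and contraction both reduce to this. -/
theorem CI.condExp_eq (hX : ∀ v, Measurable (X v)) (h : CI μ X A B C) (h1 : C ⊆ D)
    (h2 : D ⊆ B ∪ C) {t : Set Ω} (ht : MeasurableSet[sigmaOf X A] t) :
    μ⟦t | sigmaOf X D⟧ =ᵐ[μ] μ⟦t | sigmaOf X C⟧ := by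
  have h3 := condExp_condExp_of_le (μ := μ) (f := t.indicator fun _ => (1 : ℝ))
    (sigmaOf_mono X h2) (sigmaOf_le hX _)
  have h4 := condExp_congr_ae (m := sigmaOf X D) (h t ht)
  have h5 : μ[μ⟦t | sigmaOf X C⟧ | sigmaOf X D] = μ⟦t | sigmaOf X C⟧ :=
    condExp_of_stronglyMeasurable (sigmaOf_le hX D)
      (stronglyMeasurable_condExp.mono (sigmaOf_mono X h1)) integrable_condExp
  rw [h5] at h4
  exact h3.symm.trans h4

theorem CI.weak_union (hX : ∀ v, Measurable (X v)) (h : CI μ X A B C) (h1 : C ⊆ C')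
    (h2 : B' ∪ C' ⊆ B ∪ C) : CI μ X A B' C' := fun _ ht =>
  (h.condExp_eq hX (h1.trans Finset.subset_union_right) h2 ht).trans
    (h.condExp_eq hX h1 (Finset.subset_union_right.trans h2) ht).symm

theorem CI.mono_right (hX : ∀ v, Measurable (X v)) (h : CI μ X A B C) (h1 : B' ⊆ B) :
    CI μ X A B' C :=
  h.weak_union hX subset_rfl (Finset.union_subset_union_left h1)

theorem CI.contraction (hX : ∀ v, Measurable (X v)) (h : CI μ X A B C) (h1 : C ⊆ C')
    (h2 : C' ⊆ B ∪ C) (h3 : CI μ X A D C') : CI μ X A (D ∪ C') C := by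
  intro t ht
  rw [Finset.union_assoc, Finset.union_eq_left.2 h1]
  exact (h3 t ht).trans (h.condExp_eq hX h1 h2 ht)

/-- Events already decided by the conditioning variables have their indicator as conditional
probability. This covers variables that are constant or copies of a parent. -/
theorem CI.of_sigmaOf_le (hX : ∀ v, Measurable (X v)) (h : sigmaOf X A ≤ sigmaOf X C) :
    CI μ X A B C := by
  intro t ht
  have hi : ∀ E, sigmaOf X A ≤ sigmaOf X E →
      μ⟦t | sigmaOf X E⟧ = t.indicator fun _ => (1 : ℝ) := fun E hE =>
    condExp_of_stronglyMeasurable (sigmaOf_le hX E)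
      (stronglyMeasurable_const.indicator (hE t ht))
      ((integrable_const 1).indicator (sigmaOf_le hX A t ht))
  rw [hi C h, hi _ (h.trans (sigmaOf_mono X Finset.subset_union_right))]

theorem isMarkov_iff_ci [StandardBorelSpace Ω] (G : CausalDAG) (hX : ∀ v, Measurable (X v)) :
    G.IsMarkov μ X hX ↔ ∀ v ∈ G.verts, CI μ X {v} (G.nonDescendants v) (G.parents v) := by
  refine forall₂_congr fun v _ => ?_
  rw [ci_iff_condIndep hX, condIndepFun_iff_condIndep]
  simp only [comap_family_eq_sigmaOf, sigmaOf_singleton]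

end Families

end CausalDAG

namespace CausalDAG

/-! ### Sinks, deletions and interventions in DAGs -/

section Graph

variable {G K : CausalDAG} {u v w x : ℕ}

theorem left_mem_verts (h : (u, v) ∈ G.edges) : u ∈ G.verts :=
  (Finset.mem_product.1 (G.edges_subset h)).1

theorem right_mem_verts (h : (u, v) ∈ G.edges) : v ∈ G.verts :=
  (Finset.mem_product.1 (G.edges_subset h)).2

@[simp]
theorem mem_parents : u ∈ G.parents v ↔ (u, v) ∈ G.edges := by
  simp only [parents, Finset.mem_filter, and_iff_right_iff_imp]
  exact left_mem_verts

@[simp]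
theorem mem_nonDescendants : u ∈ G.nonDescendants v ↔ u ∈ G.verts ∧ ¬ G.Reaches v u := by
  simp [nonDescendants]

theorem not_reaches_of_edge (h : (u, v) ∈ G.edges) : ¬ G.Reaches v u := fun h1 =>
  G.acyclic u (Relation.TransGen.head' h h1)

theorem not_edge_self : (u, u) ∉ G.edges := fun h =>
  not_reaches_of_edge h Relation.ReflTransGen.refl

theorem not_edge_symm (h : (u, v) ∈ G.edges) : (v, u) ∉ G.edges := fun h1 =>
  not_reaches_of_edge h (Relation.ReflTransGen.single h1)

theorem Reaches.antisymm (h1 : G.Reaches u v) (h2 : G.Reaches v u) : u = v := by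
  rcases Relation.reflTransGen_iff_eq_or_transGen.1 h1 with h | h
  · exact h.symm
  · exact absurd (h.trans_left h2) (G.acyclic u)

theorem parents_subset_nonDescendants : G.parents v ⊆ G.nonDescendants v := fun _ hu =>
  mem_nonDescendants.2
    ⟨left_mem_verts (mem_parents.1 hu), not_reaches_of_edge (mem_parents.1 hu)⟩

@[simp]
theorem verts_deleteVerts (S : Finset ℕ) : (G.deleteVerts S).verts = G.verts \ S := rfl

@[simp]
theorem mem_edges_deleteVerts {S : Finset ℕ} :
    (u, v) ∈ (G.deleteVerts S).edges ↔ (u, v) ∈ G.edges ∧ u ∉ S ∧ v ∉ S := by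
  simp [deleteVerts, restrict]

@[simp]
theorem verts_intervene : (G.intervene w).verts = G.verts := rfl

@[simp]
theorem mem_edges_intervene : (u, v) ∈ (G.intervene w).edges ↔ (u, v) ∈ G.edges ∧ v ≠ w := by
  simp [intervene, restrict]

theorem ext_edges (h1 : G.verts = K.verts) (h2 : ∀ a b, (a, b) ∈ G.edges ↔ (a, b) ∈ K.edges) :
    G = K :=
  CausalDAG.ext h1 (Finset.ext fun ⟨a, b⟩ => h2 a b)

theorem Reaches.mono (h : G.edges ⊆ K.edges) (hr : G.Reaches u v) : K.Reaches u v :=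
  Relation.ReflTransGen.mono (fun _ _ hab => h hab) _ _ hr

theorem intervene_eq_self (h : w ∉ G.verts) : G.intervene w = G :=
  ext_edges rfl fun a b => by
    rw [mem_edges_intervene, and_iff_left_iff_imp]
    rintro h1 rfl
    exact h (right_mem_verts h1)

theorem intervene_deleteVerts (S : Finset ℕ) :
    (G.intervene w).deleteVerts S = (G.deleteVerts S).intervene w :=
  ext_edges rfl fun a b => by simp; tauto

theorem parents_intervene : (G.intervene w).parents v = if v = w then ∅ else G.parents v := by
  ext a
  split_ifs with h <;> simp [h]

/-- A vertex without outgoing edges. -/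
def IsSink (G : CausalDAG) (v : ℕ) : Prop := v ∈ G.verts ∧ ∀ x, (v, x) ∉ G.edges

theorem IsSink.intervene (h : G.IsSink v) (w : ℕ) : (G.intervene w).IsSink v :=
  ⟨h.1, fun x hx => h.2 x (mem_edges_intervene.1 hx).1⟩

/-- A vertex that reaches the fewest vertices works: a child would reach strictly fewer, because it
no longer reaches the vertex itself. -/
theorem exists_isSink (h : G.verts.Nonempty) : ∃ v, G.IsSink v := by
  classical
  obtain ⟨v, hv, hmin⟩ := G.verts.exists_min_image
    (fun v => (G.verts.filter fun x => G.Reaches v x).card) h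
  refine ⟨v, hv, fun x hx => ?_⟩
  refine absurd (hmin x (right_mem_verts hx)) (not_le.2 (Finset.card_lt_card ?_))
  rw [Finset.ssubset_iff_of_subset]
  · exact ⟨v, Finset.mem_filter.2 ⟨hv, Relation.ReflTransGen.refl⟩, fun h1 =>
      not_reaches_of_edge hx (Finset.mem_filter.1 h1).2⟩
  · intro y hy
    rw [Finset.mem_filter] at hy ⊢
    exact ⟨hy.1, Relation.ReflTransGen.head hx hy.2⟩

theorem IsSink.eq_of_reaches (h : G.IsSink v) (hr : G.Reaches v x) : x = v := by
  rcases Relation.ReflTransGen.cases_head hr with h1 | ⟨y, h1, -⟩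
  · exact h1.symm
  · exact absurd h1 (h.2 y)

theorem IsSink.reaches_deleteVerts_iff (h : G.IsSink v) (hx : x ≠ v) :
    (G.deleteVerts {v}).Reaches u x ↔ G.Reaches u x := by
  refine ⟨Reaches.mono fun e he => (Finset.mem_filter.1 he).1, fun hr => ?_⟩
  induction hr with
  | refl => exact Relation.ReflTransGen.refl
  | tail _ hbc ih =>
    have hb : ∀ b c, (b, c) ∈ G.edges → b ≠ v := fun b c hbc hbv => h.2 c (hbv ▸ hbc)
    refine Relation.ReflTransGen.tail (ih (hb _ _ hbc)) ?_
    exact mem_edges_deleteVerts.2 ⟨hbc, by simpa using hb _ _ hbc, by simpa using hx⟩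

theorem IsSink.nonDescendants (h : G.IsSink v) : G.nonDescendants v = G.verts \ {v} := by
  ext x
  rw [mem_nonDescendants, Finset.mem_sdiff, Finset.mem_singleton]
  refine and_congr_right fun _ => not_congr ⟨h.eq_of_reaches, ?_⟩
  rintro rfl
  exact Relation.ReflTransGen.refl

theorem parents_deleteVerts_sink (h : G.IsSink v) (hu : u ≠ v) :
    (G.deleteVerts {v}).parents u = G.parents u := by
  ext a
  simp only [mem_parents, mem_edges_deleteVerts, Finset.mem_singleton]
  exact ⟨fun h1 => h1.1, fun h1 => ⟨h1, fun h2 => h.2 u (h2 ▸ h1), hu⟩⟩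

theorem IsSink.nonDescendants_deleteVerts (h : G.IsSink v) :
    (G.deleteVerts {v}).nonDescendants u = G.nonDescendants u \ {v} := by
  ext x
  simp only [mem_nonDescendants, verts_deleteVerts, Finset.mem_sdiff, Finset.mem_singleton]
  by_cases hx : x = v
  · simp [hx]
  · rw [h.reaches_deleteVerts_iff hx]; tauto

end Graph

/-! ### The Markov property under deletion of a sink and under intervention -/

section Markov

variable {Ω : Type} [MeasurableSpace Ω] [StandardBorelSpace Ω] {μ : Measure Ω}
  [IsProbabilityMeasure μ] {X : ℕ → Ω → ℝ} {G K : CausalDAG} {v w : ℕ}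

/-- The Markov property can be checked by removing a sink. -/
theorem IsSink.isMarkov_iff (hX : ∀ v, Measurable (X v)) (h : G.IsSink v) :
    G.IsMarkov μ X hX ↔
      (G.deleteVerts {v}).IsMarkov μ X hX ∧ CI μ X {v} (G.verts \ {v}) (G.parents v) := by
  rw [isMarkov_iff_ci, isMarkov_iff_ci]
  constructor
  · intro hG
    refine ⟨fun u hu => ?_, h.nonDescendants ▸ hG v h.1⟩
    obtain ⟨hu1, hu2⟩ := Finset.mem_sdiff.1 hu
    rw [parents_deleteVerts_sink h (by simpa using hu2), h.nonDescendants_deleteVerts]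
    exact (hG u hu1).mono_right hX Finset.sdiff_subset
  · rintro ⟨hH, hv⟩ u hu
    by_cases huv : u = v
    · rw [huv, h.nonDescendants]
      exact hv
    have h1 := hH u (Finset.mem_sdiff.2 ⟨hu, by simpa using huv⟩)
    rw [parents_deleteVerts_sink h huv, h.nonDescendants_deleteVerts] at h1
    by_cases hr : G.Reaches u v
    · rwa [Finset.sdiff_singleton_eq_erase,
        Finset.erase_eq_of_notMem fun h2 => (mem_nonDescendants.1 h2).2 hr] at h1
    -- Here `v` is a nondescendant of `u`, and so are its parents. By weak union `v` is independent
    -- of `u` given the other nondescendants of `u`; contraction with `h1` then adds `v` to them.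
    have h2 : G.parents v ⊆ G.nonDescendants u \ {v} := by
      intro a ha
      rw [Finset.mem_sdiff, mem_nonDescendants, Finset.mem_singleton]
      rw [mem_parents] at ha
      exact ⟨⟨left_mem_verts ha, fun h3 => hr (h3.tail ha)⟩, fun h3 => h.2 v (h3 ▸ ha)⟩
    have h3 : G.nonDescendants u \ {v} ⊆ G.verts \ {v} :=
      Finset.sdiff_subset_sdiff (fun a ha => (mem_nonDescendants.1 ha).1) subset_rfl
    have h4 : CI μ X {v} {u} (G.nonDescendants u \ {v}) := by
      refine hv.weak_union hX h2 (Finset.union_subset ?_ (h3.trans Finset.subset_union_left))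
      intro a ha
      rw [Finset.mem_singleton.1 ha]
      exact Finset.mem_union_left _ (Finset.mem_sdiff.2 ⟨hu, by simpa using huv⟩)
    have h5 : G.parents u ⊆ G.nonDescendants u \ {v} := by
      rw [← parents_deleteVerts_sink h huv, ← h.nonDescendants_deleteVerts]
      exact parents_subset_nonDescendants
    refine (h1.contraction hX h5 Finset.subset_union_left (h4.symm hX)).mono_right hX ?_
    intro a ha
    by_cases hav : a = v
    · simp [hav]
    · exact Finset.mem_union_right _ (Finset.mem_sdiff.2 ⟨ha, by simpa using hav⟩)

theorem isMarkov_congr {Y : ℕ → Ω → ℝ} (hX : ∀ v, Measurable (X v)) (hY : ∀ v, Measurable (Y v))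
    (h : ∀ u ∈ G.verts, X u = Y u) : G.IsMarkov μ X hX ↔ G.IsMarkov μ Y hY := by
  rw [isMarkov_iff_ci, isMarkov_iff_ci]
  refine forall₂_congr fun v hv => ci_congr (fun u hu => ?_) (fun u hu => ?_) (fun u hu => ?_)
  · exact h u (Finset.mem_singleton.1 hu ▸ hv)
  · exact h u (mem_nonDescendants.1 hu).1
  · exact h u (left_mem_verts (mem_parents.1 hu))

/-- The Markov property for `G^(w)` is that for `G`, together with the independence of `w` and
its parents. -/
theorem isMarkov_intervene_iff (hX : ∀ v, Measurable (X v)) (hw : w ∈ G.verts) :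
    (G.intervene w).IsMarkov μ X hX ↔ G.IsMarkov μ X hX ∧ CI μ X {w} (G.parents w) ∅ := by
  constructor
  · intro h
    rw [isMarkov_iff_ci] at h
    have hnd : ∀ u, G.nonDescendants u ⊆ (G.intervene w).nonDescendants u := fun u a ha => by
      rw [mem_nonDescendants] at ha ⊢
      exact ⟨ha.1, fun h1 => ha.2 (h1.mono (Finset.filter_subset _ _))⟩
    refine ⟨(isMarkov_iff_ci G hX).2 fun u hu => ?_, ?_⟩
    · refine (h u hu).weak_union hX (fun a ha => ?_)
        ((Finset.union_subset (hnd u) (parents_subset_nonDescendants.trans (hnd u))).trans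
          Finset.subset_union_left)
      rw [mem_parents] at ha ⊢
      exact (mem_edges_intervene.1 ha).1
    · have h1 := h w hw
      rw [parents_intervene, if_pos rfl] at h1
      exact h1.mono_right hX (parents_subset_nonDescendants.trans (hnd w))
  · rintro ⟨hG, hc⟩
    -- Remove a sink `v`. If `v = w`, the smaller graph does not feel the intervention, and
    -- contraction makes `w` independent of everything else; if `v ≠ w`, the condition at `v` is the
    -- same in both graphs.
    induction hn : G.verts.card generalizing G with
    | zero => exact absurd hw (by simp [Finset.card_eq_zero.1 hn])
    | succ n ih =>
      obtain ⟨v, hv⟩ := exists_isSink ⟨w, hw⟩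
      rw [(hv.intervene w).isMarkov_iff, parents_intervene, verts_intervene,
        intervene_deleteVerts]
      rw [hv.isMarkov_iff] at hG
      by_cases hvw : w = v
      · rw [if_pos hvw.symm, ← hvw]
        rw [← hvw] at hG
        refine ⟨?_, ?_⟩
        · rw [intervene_eq_self (by simp)]
          exact hG.1
        · exact (hc.contraction hX (Finset.empty_subset _) Finset.subset_union_left hG.2).mono_right
            hX Finset.subset_union_left
      · rw [if_neg (Ne.symm hvw)]
        refine ⟨ih ?_ hG.1 ?_ ?_, hG.2⟩
        · simp [hw, hvw]
        · rwa [parents_deleteVerts_sink hv hvw]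
        · rw [verts_deleteVerts, Finset.card_sdiff_of_subset (by simpa using hv.1), hn]
          simp

end Markov

/-! ### Markov equivalence under deletion of a sink and under intervention -/

section Equiv

variable {G K : CausalDAG} {v w : ℕ}

theorem MarkovEquiv.symm (h : MarkovEquiv G K) : MarkovEquiv K G :=
  ⟨h.1.symm, fun Ω _ _ μ _ X hX => (h.2 Ω μ X hX).symm⟩

/-- The intervened Markov property adds to the observational one only the independence of `w` from
its parents, a condition depending on the graph through these parents alone. -/
theorem MarkovEquiv.intervene (h : MarkovEquiv G K) (hp : G.parents w = K.parents w) :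
    MarkovEquiv (G.intervene w) (K.intervene w) := by
  by_cases hw : w ∈ G.verts
  · refine ⟨h.1, fun Ω _ _ μ _ X hX => ?_⟩
    rw [isMarkov_intervene_iff hX hw, isMarkov_intervene_iff hX (h.1 ▸ hw), hp, h.2 Ω μ X hX]
  · rwa [intervene_eq_self hw, intervene_eq_self (h.1 ▸ hw)]

theorem markovEquiv_deleteVerts_iff (hG : G.IsSink v) (hK : K.IsSink v)
    (hp : G.parents v = K.parents v) :
    MarkovEquiv (G.deleteVerts {v}) (K.deleteVerts {v}) ↔ MarkovEquiv G K := by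
  have hverts : G.verts \ {v} = K.verts \ {v} ↔ G.verts = K.verts := by
    refine ⟨fun h => ?_, fun h => by rw [h]⟩
    rw [← Finset.sdiff_union_of_subset (Finset.singleton_subset_iff.2 hG.1), h,
      Finset.sdiff_union_of_subset (Finset.singleton_subset_iff.2 hK.1)]
  constructor
  · intro h
    have h1 := hverts.1 h.1
    refine ⟨h1, fun Ω _ _ μ _ X hX => ?_⟩
    rw [hG.isMarkov_iff, hK.isMarkov_iff, h.2 Ω μ X hX, hp, h1]
  · intro h
    refine ⟨hverts.2 h.1, fun Ω _ _ μ _ X hX => ?_⟩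
    -- Variables for the smaller graphs extend to `v` by the constant `0`, which satisfies the
    -- condition at the sink trivially.
    have hY : ∀ u, Measurable (Function.update X v 0 u) := by
      intro u
      by_cases huv : u = v
      · rw [huv, Function.update_self]
        exact measurable_const
      · rw [Function.update_of_ne huv]
        exact hX u
    have h1 : ∀ H : CausalDAG, H.IsSink v →
        ((H.deleteVerts {v}).IsMarkov μ X hX ↔ H.IsMarkov μ (Function.update X v 0) hY) := by
      intro H hH
      rw [hH.isMarkov_iff, isMarkov_congr hX hY, and_iff_left]
      · refine CI.of_sigmaOf_le hY ?_
        rw [sigmaOf_singleton, Function.update_self]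
        exact (MeasurableSpace.comap_const (m := inferInstance) (0 : ℝ)).trans_le bot_le
      · intro u hu
        rw [Function.update_of_ne]
        simpa using (Finset.mem_sdiff.1 hu).2
    rw [h1 G hG, h1 K hK, h.2]

theorem iMarkovEquiv_deleteVerts_iff (hG : G.IsSink v) (hK : K.IsSink v)
    (hp : G.parents v = K.parents v) (J : Finset ℕ) :
    IMarkovEquiv J (G.deleteVerts {v}) (K.deleteVerts {v}) ↔ IMarkovEquiv J G K := by
  refine and_congr (markovEquiv_deleteVerts_iff hG hK hp) (forall₂_congr fun u _ => ?_)
  rw [← intervene_deleteVerts, ← intervene_deleteVerts]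
  refine markovEquiv_deleteVerts_iff (hG.intervene u) (hK.intervene u) ?_
  rw [parents_intervene, parents_intervene, hp]

end Equiv

end CausalDAG

namespace CausalDAG

/-! ### The coin test: skeleton and v-structures from Markov equivalence -/

section Coin

/-- The law of a fair coin. -/
noncomputable def coinMeasure : Measure Bool := (PMF.uniformOfFintype Bool).toMeasure

instance : IsProbabilityMeasure coinMeasure := PMF.toMeasure.isProbabilityMeasure _

open Classical in
/-- Variables that all show the same coin for the labels in `S`, and vanish for the others. -/
noncomputable def coinVar (S : Finset ℕ) (u : ℕ) (b : Bool) : ℝ := if u ∈ S ∧ b = true then 1 else 0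

theorem measurable_coinVar (S : Finset ℕ) (u : ℕ) : Measurable (coinVar S u) :=
  measurable_of_finite _

theorem coinVar_congr {S : Finset ℕ} {u v : ℕ} (hu : u ∈ S) (hv : v ∈ S) :
    coinVar S u = coinVar S v := by
  funext b
  simp [coinVar, hu, hv]

theorem sigmaOf_coinVar_eq_bot {S T : Finset ℕ} (h : ∀ u ∈ T, u ∉ S) :
    sigmaOf (coinVar S) T = ⊥ := by
  rw [← le_bot_iff]
  refine iSup₂_le fun u hu => ?_
  have h1 : coinVar S u = fun _ => 0 := by
    funext b
    simp [coinVar, h u hu]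
  rw [h1]
  exact (MeasurableSpace.comap_const (m := inferInstance) (0 : ℝ)).le

theorem measurableSet_sigmaOf_coinVar {S T : Finset ℕ} {u : ℕ} (hT : u ∈ T) (hS : u ∈ S) :
    MeasurableSet[sigmaOf (coinVar S) T] {true} := by
  refine le_iSup₂_of_le (f := fun u (_ : u ∈ T) =>
    MeasurableSpace.comap (coinVar S u) inferInstance) u hT le_rfl _
      ⟨{1}, measurableSet_singleton _, ?_⟩
  ext b
  cases b <;> simp [coinVar, hS]

variable {G K : CausalDAG} {S : Finset ℕ} {s a b c : ℕ}

/-- A vertex of `S` other than the root `s` copies a parent, the nondescendants of `s` carry only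
constants, and vertices outside `S` are constant. -/
theorem isMarkov_coinVar (h1 : ∀ u ∈ S, u ≠ s → ∃ p ∈ S, (p, u) ∈ G.edges)
    (h2 : ∀ u ∈ S, G.Reaches s u) :
    G.IsMarkov coinMeasure (coinVar S) (measurable_coinVar S) := by
  have hX := measurable_coinVar S
  rw [isMarkov_iff_ci]
  intro u _
  by_cases huS : u ∈ S
  · by_cases hus : u = s
    · refine (CI.of_sigmaOf_le hX ?_).symm hX
      rw [sigmaOf_coinVar_eq_bot]
      · exact bot_le
      · intro x hx hxS
        exact (mem_nonDescendants.1 hx).2 (hus ▸ h2 x hxS)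
    · obtain ⟨p, hp, hpu⟩ := h1 u huS hus
      refine CI.of_sigmaOf_le hX ?_
      rw [sigmaOf_singleton, coinVar_congr huS hp, ← sigmaOf_singleton]
      exact sigmaOf_mono _ (by simpa using hpu)
  · refine CI.of_sigmaOf_le hX ?_
    rw [sigmaOf_coinVar_eq_bot]
    · exact bot_le
    · intro x hx
      rwa [Finset.mem_singleton.1 hx]

/-- Without a parent in `S`, the coin at `b` would be independent of the same coin at its
nondescendant `a`. Its conditional probability would be both an indicator and `1 / 2`. -/
theorem exists_parent_of_isMarkov_coinVar
    (h : G.IsMarkov coinMeasure (coinVar S) (measurable_coinVar S)) (ha : a ∈ S) (hb : b ∈ S)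
    (haG : a ∈ G.verts) (hbG : b ∈ G.verts) (hba : ¬ G.Reaches b a) :
    ∃ p ∈ S, (p, b) ∈ G.edges := by
  have hX := measurable_coinVar S
  by_contra! hp
  have h1 := (isMarkov_iff_ci G hX).1 h b hbG {true}
    (measurableSet_sigmaOf_coinVar (Finset.mem_singleton_self b) hb)
  have hbot : sigmaOf (coinVar S) (G.parents b) = ⊥ :=
    sigmaOf_coinVar_eq_bot fun u hu huS => hp u huS (mem_parents.1 hu)
  have h2 : coinMeasure⟦{true} | sigmaOf (coinVar S) (G.nonDescendants b ∪ G.parents b)⟧ =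
      ({true} : Set Bool).indicator fun _ => (1 : ℝ) := by
    refine condExp_of_stronglyMeasurable (sigmaOf_le hX _)
      (stronglyMeasurable_const.indicator (measurableSet_sigmaOf_coinVar (u := a) ?_ ha))
      ((integrable_const 1).indicator (measurableSet_singleton _))
    exact Finset.mem_union_left _ (mem_nonDescendants.2 ⟨haG, hba⟩)
  have hr : coinMeasure.real {true} = 1 / 2 := by
    rw [measureReal_def, coinMeasure, PMF.toMeasure_apply_singleton _ _ (measurableSet_singleton _)]
    simp
  rw [h2, hbot, condExp_bot] at h1
  obtain ⟨ω, hω⟩ := h1.exists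
  rw [integral_indicator_const _ (measurableSet_singleton _), hr] at hω
  cases ω <;> norm_num at hω

/-- By acyclicity one of `a`, `b` is not a descendant of the other, so the parent criterion applies
to at least one of them. -/
theorem exists_edge_of_isMarkov_coinVar
    (h : G.IsMarkov coinMeasure (coinVar S) (measurable_coinVar S)) (ha : a ∈ S) (hb : b ∈ S)
    (haG : a ∈ G.verts) (hbG : b ∈ G.verts) (hab : a ≠ b) :
    ∃ p ∈ S, (p, a) ∈ G.edges ∨ (p, b) ∈ G.edges := by
  by_cases hr : G.Reaches b a
  · obtain ⟨p, hp, h1⟩ := exists_parent_of_isMarkov_coinVar h hb ha hbG haG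
      fun h1 => hab (Reaches.antisymm h1 hr)
    exact ⟨p, hp, Or.inl h1⟩
  · obtain ⟨p, hp, h1⟩ := exists_parent_of_isMarkov_coinVar h ha hb haG hbG hr
    exact ⟨p, hp, Or.inr h1⟩

/-- Markov equivalent graphs have the same skeleton. -/
theorem MarkovEquiv.edge_or_edge (h : MarkovEquiv G K) (hab : (a, b) ∈ G.edges) :
    (a, b) ∈ K.edges ∨ (b, a) ∈ K.edges := by
  have hG : G.IsMarkov coinMeasure (coinVar {a, b}) (measurable_coinVar {a, b}) := by
    refine isMarkov_coinVar (s := a) ?_ ?_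
    · intro u hu hua
      have : u = b := by simpa [hua] using hu
      exact ⟨a, by simp, this ▸ hab⟩
    · intro u hu
      rcases Finset.mem_insert.1 hu with rfl | hu
      · exact Relation.ReflTransGen.refl
      · rw [Finset.mem_singleton.1 hu]
        exact Relation.ReflTransGen.single hab
  obtain ⟨p, hp, h1⟩ := exists_edge_of_isMarkov_coinVar ((h.2 _ _ _ _).1 hG)
    (Finset.mem_insert_self a {b}) (by simp) (h.1 ▸ left_mem_verts hab)
    (h.1 ▸ right_mem_verts hab) (fun hab' => not_edge_self (hab' ▸ hab))
  rcases Finset.mem_insert.1 hp with rfl | hp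
  · exact Or.inl (h1.resolve_left not_edge_self)
  · rw [Finset.mem_singleton.1 hp] at h1
    exact Or.inr (h1.resolve_right not_edge_self)

/-- Markov equivalent graphs have the same v-structures. -/
theorem MarkovEquiv.edge_of_vStructure (h : MarkovEquiv G K) (hac : (a, c) ∈ G.edges)
    (hbc : (b, c) ∈ G.edges) (hne : a ≠ b) (hab : (a, b) ∉ G.edges) (hba : (b, a) ∉ G.edges) :
    (a, c) ∈ K.edges := by
  refine (h.edge_or_edge hac).resolve_right fun hca => ?_
  -- If `K` had `c → a`, then `a, b, c` would form a chain from `b` or a fork at `c`, and a common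
  -- coin would be Markov for `K`. In `G` neither `a` nor `b` has a parent among the three.
  have hK : K.IsMarkov coinMeasure (coinVar {a, b, c}) (measurable_coinVar {a, b, c}) := by
    rcases h.edge_or_edge hbc with hbc' | hcb
    · refine isMarkov_coinVar (s := b) ?_ ?_
      · intro u hu hub
        simp only [Finset.mem_insert, Finset.mem_singleton, hub, false_or] at hu
        rcases hu with rfl | rfl
        · exact ⟨c, by simp, hca⟩
        · exact ⟨b, by simp, hbc'⟩
      · intro u hu
        simp only [Finset.mem_insert, Finset.mem_singleton] at hu
        rcases hu with rfl | rfl | rfl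
        · exact (Relation.ReflTransGen.single hbc').tail hca
        · exact Relation.ReflTransGen.refl
        · exact Relation.ReflTransGen.single hbc'
    · refine isMarkov_coinVar (s := c) ?_ ?_
      · intro u hu huc
        simp only [Finset.mem_insert, Finset.mem_singleton, huc, or_false] at hu
        rcases hu with rfl | rfl
        · exact ⟨c, by simp, hca⟩
        · exact ⟨c, by simp, hcb⟩
      · intro u hu
        simp only [Finset.mem_insert, Finset.mem_singleton] at hu
        rcases hu with rfl | rfl | rfl
        · exact Relation.ReflTransGen.single hca
        · exact Relation.ReflTransGen.single hcb
        · exact Relation.ReflTransGen.refl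
  obtain ⟨p, hp, h1⟩ := exists_edge_of_isMarkov_coinVar ((h.2 _ _ _ _).2 hK)
    (Finset.mem_insert_self a _) (by simp) (left_mem_verts hac) (left_mem_verts hbc) hne
  simp only [Finset.mem_insert, Finset.mem_singleton] at hp
  rcases hp with rfl | rfl | rfl
  · exact h1.elim not_edge_self hab
  · exact h1.elim hba not_edge_self
  · exact h1.elim (not_edge_symm hac) (not_edge_symm hbc)

end Coin

/-! ### Essential graphs, shielded sinks and the core -/

section Essential

variable {G K : CausalDAG} {a b u v w : ℕ} {J J' : Finset ℕ}

theorem mem_undirected {e : Sym2 ℕ} : e ∈ (G.essentialGraph J).undirected ↔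
    ∃ a b, (a, b) ∈ G.edges ∧ (∃ H, IMarkovEquiv J G H ∧ (a, b) ∉ H.edges) ∧ s(a, b) = e := by
  simp only [essentialGraph, Finset.mem_image, Finset.mem_filter, Prod.exists, not_forall,
    exists_prop, and_assoc]

theorem iMarkovEquiv_empty : IMarkovEquiv ∅ G K ↔ MarkovEquiv G K := by
  simp [IMarkovEquiv]

/-- A sink `v` such that every edge into `v` is part of a v-structure. -/
def IsShieldedSink (G : CausalDAG) (v : ℕ) : Prop :=
  G.IsSink v ∧ ∀ a, (a, v) ∈ G.edges →
    ∃ b, (b, v) ∈ G.edges ∧ a ≠ b ∧ (a, b) ∉ G.edges ∧ (b, a) ∉ G.edges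

/-- The v-structures fix every edge into `v`, and the common skeleton leaves no other edge at `v`.
-/
theorem IsShieldedSink.of_markovEquiv (hv : G.IsShieldedSink v) (h : MarkovEquiv G K) :
    K.IsSink v ∧ G.parents v = K.parents v := by
  have h1 : ∀ a, (a, v) ∈ G.edges → (a, v) ∈ K.edges := by
    intro a ha
    obtain ⟨b, hb, hne, h1, h2⟩ := hv.2 a ha
    exact h.edge_of_vStructure ha hb hne h1 h2
  have h2 : ∀ a, (a, v) ∈ K.edges → (a, v) ∈ G.edges := fun a ha =>
    (h.symm.edge_or_edge ha).resolve_right (hv.1.2 a)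
  refine ⟨⟨h.1 ▸ hv.1.1, fun x hx => ?_⟩, ?_⟩
  · exact not_edge_symm hx
      (h1 x ((h.symm.edge_or_edge hx).resolve_left (hv.1.2 x)))
  · ext a
    rw [mem_parents, mem_parents]
    exact ⟨h1 a, h2 a⟩

/-- The graph `G` with a sink `v` added, with parents `P`. -/
def addSink (G : CausalDAG) (v : ℕ) (P : Finset ℕ) (hP : P ⊆ G.verts) (hv : v ∉ G.verts) :
    CausalDAG where
  verts := insert v G.verts
  edges := G.edges ∪ P ×ˢ {v}
  edges_subset := by
    refine Finset.union_subset (G.edges_subset.trans ?_) ?_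
    · exact Finset.product_subset_product (Finset.subset_insert _ _) (Finset.subset_insert _ _)
    · exact Finset.product_subset_product (hP.trans (Finset.subset_insert _ _)) (by simp)
  acyclic x h := by
    have hcases : ∀ a b, (a, b) ∈ G.edges ∪ P ×ˢ {v} → a ≠ v ∧ ((a, b) ∈ G.edges ∨ b = v) := by
      intro a b hab
      rcases Finset.mem_union.1 hab with h1 | h1
      · exact ⟨fun h2 => hv (h2 ▸ left_mem_verts h1), Or.inl h1⟩
      · obtain ⟨h2, h3⟩ := Finset.mem_product.1 h1
        exact ⟨fun h4 => hv (h4 ▸ hP h2), Or.inr (by simpa using h3)⟩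
    have key : ∀ a b, Relation.TransGen (fun i j => (i, j) ∈ G.edges ∪ P ×ˢ {v}) a b →
        a ≠ v ∧ (b = v ∨ Relation.TransGen (fun i j => (i, j) ∈ G.edges) a b) := by
      intro a b hab
      induction hab with
      | single h1 =>
        obtain ⟨h2, h3⟩ := hcases _ _ h1
        exact ⟨h2, h3.symm.imp_right Relation.TransGen.single⟩
      | tail _ h1 ih =>
        obtain ⟨h2, h3⟩ := hcases _ _ h1
        refine ⟨ih.1, ?_⟩
        rcases h3 with h3 | h3
        · exact Or.inr ((ih.2.resolve_left h2).tail h3)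
        · exact Or.inl h3
    obtain ⟨h1, h2⟩ := key x x h
    exact G.acyclic x (h2.resolve_left h1)

section addSink

variable {P : Finset ℕ} (hP : P ⊆ G.verts) (hv : v ∉ G.verts)

theorem mem_edges_addSink :
    (a, b) ∈ (G.addSink v P hP hv).edges ↔ (a, b) ∈ G.edges ∨ a ∈ P ∧ b = v := by
  simp [addSink, eq_comm]

theorem isSink_addSink : (G.addSink v P hP hv).IsSink v := by
  refine ⟨Finset.mem_insert_self _ _, fun x hx => ?_⟩
  rcases (mem_edges_addSink hP hv).1 hx with h | h
  · exact hv (left_mem_verts h)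
  · exact hv (hP h.1)

theorem parents_addSink : (G.addSink v P hP hv).parents v = P := by
  ext a
  rw [mem_parents, mem_edges_addSink, or_iff_right fun h => hv (right_mem_verts h)]
  simp

theorem addSink_deleteVerts : (G.addSink v P hP hv).deleteVerts {v} = G := by
  refine ext_edges ?_ fun a b => ?_
  · ext x
    simp only [addSink, verts_deleteVerts, Finset.mem_sdiff, Finset.mem_insert,
      Finset.mem_singleton]
    constructor
    · tauto
    · exact fun h => ⟨Or.inr h, fun h1 => hv (h1 ▸ h)⟩
  · rw [mem_edges_deleteVerts, mem_edges_addSink, Finset.mem_singleton, Finset.mem_singleton]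
    constructor
    · tauto
    · exact fun h => ⟨Or.inl h, fun h1 => hv (h1 ▸ left_mem_verts h),
        fun h1 => hv (h1 ▸ right_mem_verts h)⟩

end addSink

/-- Deleting a sink all of whose edges are part of v-structures does not change the undirected
edges of the essential graphs. -/
theorem IsShieldedSink.undirected_deleteVerts (hv : G.IsShieldedSink v) (J : Finset ℕ) :
    ((G.deleteVerts {v}).essentialGraph J).undirected = (G.essentialGraph J).undirected := by
  ext e
  rw [mem_undirected, mem_undirected]
  refine exists₂_congr fun a b => ?_
  constructor
  · rintro ⟨hab, ⟨H, hH, hH'⟩, rfl⟩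
    obtain ⟨hab1, ha, hb⟩ := mem_edges_deleteVerts.1 hab
    have hvH : v ∉ H.verts := by
      rw [← hH.1.1]
      simp
    have hP : G.parents v ⊆ H.verts := by
      rw [← hH.1.1, verts_deleteVerts]
      intro x hx
      rw [Finset.mem_sdiff, Finset.mem_singleton]
      rw [mem_parents] at hx
      exact ⟨left_mem_verts hx, fun h => hv.1.2 v (h ▸ hx)⟩
    -- A witness for the smaller graph becomes one for `G` by restoring `v` with its parents in `G`;
    -- conversely, `v` can be deleted from any witness for `G`.
    refine ⟨hab1, ⟨H.addSink v (G.parents v) hP hvH, ?_, ?_⟩, rfl⟩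
    · rw [← iMarkovEquiv_deleteVerts_iff hv.1 (isSink_addSink hP hvH)
        (parents_addSink hP hvH).symm, addSink_deleteVerts]
      exact hH
    · rw [mem_edges_addSink]
      rintro (h | h)
      · exact hH' h
      · exact hb (by simp [h.2])
  · rintro ⟨hab, ⟨H, hH, hH'⟩, rfl⟩
    obtain ⟨h1, h2⟩ := hv.of_markovEquiv hH.1
    refine ⟨mem_edges_deleteVerts.2 ⟨hab, ?_, ?_⟩, ⟨H.deleteVerts {v}, ?_, ?_⟩, rfl⟩
    · rw [Finset.mem_singleton]
      rintro rfl
      exact hv.1.2 b hab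
    · rw [Finset.mem_singleton]
      rintro rfl
      rw [← mem_parents, h2, mem_parents] at hab
      exact hH' hab
    · exact (iMarkovEquiv_deleteVerts_iff hv.1 h1 h2 J).2 hH
    · exact fun h => hH' (mem_edges_deleteVerts.1 h).1

theorem verts_core : G.core.verts = G.verts \ G.downstream := rfl

theorem mem_downstream : v ∈ G.downstream ↔ v ∈ G.verts ∧
    ∀ w, G.Reaches v w → ∀ e ∈ (G.essentialGraph ∅).undirected, w ∉ e := by
  simp [downstream]

theorem mem_verts_of_mem_undirected {e : Sym2 ℕ} (he : e ∈ (G.essentialGraph J).undirected)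
    (hv : v ∈ e) : v ∈ G.verts := by
  obtain ⟨a, b, hab, -, rfl⟩ := mem_undirected.1 he
  rcases Sym2.mem_iff.1 hv with rfl | rfl
  · exact left_mem_verts hab
  · exact right_mem_verts hab

theorem IsShieldedSink.mem_downstream_deleteVerts_iff (hv : G.IsShieldedSink v) (hu : u ≠ v) :
    u ∈ (G.deleteVerts {v}).downstream ↔ u ∈ G.downstream := by
  rw [mem_downstream, mem_downstream, hv.undirected_deleteVerts]
  refine and_congr (by simp [hu]) ⟨fun h w hw => ?_, fun h w hw => h w ?_⟩
  · by_cases hwv : w = v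
    · rw [hwv, ← hv.undirected_deleteVerts]
      intro e he hve
      simpa using mem_verts_of_mem_undirected he hve
    · exact h w ((hv.1.reaches_deleteVerts_iff hwv).2 hw)
  · exact hw.mono fun e he => (Finset.mem_filter.1 he).1

theorem IsShieldedSink.mem_downstream (hv : G.IsShieldedSink v) : v ∈ G.downstream := by
  refine CausalDAG.mem_downstream.2 ⟨hv.1.1, fun w hw e he hwe => ?_⟩
  rw [hv.1.eq_of_reaches hw] at hwe
  rw [← hv.undirected_deleteVerts] at he
  simpa using mem_verts_of_mem_undirected he hwe

/-- The undirected observational edges are the same, so the remaining vertices keep their downstream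
status, and `v` itself is downstream. -/
theorem IsShieldedSink.core_deleteVerts (hv : G.IsShieldedSink v) :
    (G.deleteVerts {v}).core = G.core := by
  have key : ∀ x, x ∉ ({v} : Finset ℕ) ∧ x ∉ (G.deleteVerts {v}).downstream ↔
      x ∉ G.downstream := by
    intro x
    by_cases hx : x = v
    · simp [hx, hv.mem_downstream]
    · simp [hx, hv.mem_downstream_deleteVerts_iff hx]
  refine ext_edges ?_ fun a b => ?_
  · ext x
    rw [verts_core, verts_core, verts_deleteVerts, Finset.mem_sdiff, Finset.mem_sdiff,
      Finset.mem_sdiff, and_assoc, key]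
  · rw [core, core, mem_edges_deleteVerts, mem_edges_deleteVerts, mem_edges_deleteVerts,
      ← key a, ← key b]
    tauto

/-- No observationally undirected edge meets `w`, so every edge at `w` keeps its orientation in `K`.
Hence intervening at `w` reveals nothing. -/
theorem MarkovEquiv.parents_eq_of_mem_downstream (h : MarkovEquiv G K) (hw : w ∈ G.downstream) :
    G.parents w = K.parents w := by
  have hdir : ∀ a b, (a, b) ∈ G.edges → (w = a ∨ w = b) → (a, b) ∈ K.edges := by
    intro a b hab hwab
    by_contra hK
    exact (CausalDAG.mem_downstream.1 hw).2 w Relation.ReflTransGen.refl s(a, b)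
      (mem_undirected.2 ⟨a, b, hab, ⟨K, iMarkovEquiv_empty.2 h, hK⟩, rfl⟩) (Sym2.mem_iff.2 hwab)
  ext a
  rw [mem_parents, mem_parents]
  refine ⟨fun h1 => hdir a w h1 (Or.inr rfl), fun h1 => ?_⟩
  exact (h.symm.edge_or_edge h1).resolve_right fun h2 =>
    not_edge_symm h1 (hdir w a h2 (Or.inl rfl))

/-- Interventions outside of `G ∖ G'` have no effect. -/
theorem IMarkovEquiv.of_inter_core_subset (hJ : J' ∩ G.core.verts ⊆ J) (h : IMarkovEquiv J G K) :
    IMarkovEquiv J' G K := by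
  refine ⟨h.1, fun w hw => ?_⟩
  by_cases hwc : w ∈ G.core.verts
  · exact h.2 w (hJ (Finset.mem_inter.2 ⟨hw, hwc⟩))
  by_cases hwG : w ∈ G.verts
  · rw [verts_core, Finset.mem_sdiff, not_and_not_right] at hwc
    exact h.1.intervene (h.1.parents_eq_of_mem_downstream (hwc hwG))
  · rw [intervene_eq_self hwG, intervene_eq_self (h.1.1 ▸ hwG)]
    exact h.1

theorem undirected_congr_of_inter_core (h : J ∩ G.core.verts = J' ∩ G.core.verts) :
    (G.essentialGraph J).undirected = (G.essentialGraph J').undirected := by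
  have h1 : ∀ H, IMarkovEquiv J G H ↔ IMarkovEquiv J' G H := fun H =>
    ⟨fun hH => hH.of_inter_core_subset (h ▸ Finset.inter_subset_left),
      fun hH => hH.of_inter_core_subset (h ▸ Finset.inter_subset_left)⟩
  ext e
  simp only [mem_undirected, h1]

theorem card_undirected_le : (G.essentialGraph J).undirected.card ≤ G.verts.card.choose 2 := by
  rw [← Sym2.card_image_offDiag]
  refine Finset.card_le_card fun e he => ?_
  obtain ⟨a, b, hab, -, rfl⟩ := mem_undirected.1 he
  refine Finset.mem_image.2 ⟨(a, b), Finset.mem_offDiag.2 ⟨left_mem_verts hab,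
    right_mem_verts hab, fun h => not_edge_self (G := G) (u := a) ?_⟩, rfl⟩
  rwa [← show a = b from h] at hab

end Essential

end CausalDAG

/-- Both graphs have the same core, on which the two choices of interventions coincide; only
interventions in the core affect the essential graph. -/
theorem InterventionAlgorithm.DownstreamIndependent.undirectedCount_deleteVerts
    {A : InterventionAlgorithm} (hA : A.DownstreamIndependent) (r : ℕ) {G : CausalDAG} {v : ℕ}
    (hv : G.IsShieldedSink v) :
    A.undirectedCount r (G.deleteVerts {v}) = A.undirectedCount r G := by
  have h1 := hA r G
  have h2 := hA r (G.deleteVerts {v})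
  rw [undirectedCount, undirectedCount, ← hv.undirected_deleteVerts]
  refine congrArg _ (CausalDAG.undirected_congr_of_inter_core ?_)
  rw [h2, hv.core_deleteVerts, h1]

namespace CausalDAG

/-! ### Invariance under renaming of the vertices -/

section Relabel

variable {G K : CausalDAG} {f : ℕ ↪ ℕ} {a b v x y : ℕ} {J : Finset ℕ}

@[simp]
theorem verts_relabel : (G.relabel f).verts = G.verts.map f := rfl

theorem mem_edges_relabel :
    (x, y) ∈ (G.relabel f).edges ↔ ∃ a b, (a, b) ∈ G.edges ∧ f a = x ∧ f b = y := by
  simp [relabel]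

@[simp]
theorem map_mem_edges_relabel : (f a, f b) ∈ (G.relabel f).edges ↔ (a, b) ∈ G.edges := by
  simp [mem_edges_relabel]

theorem parents_relabel : (G.relabel f).parents (f v) = (G.parents v).map f := by
  ext x
  simp [mem_edges_relabel]

theorem reaches_relabel_iff :
    (G.relabel f).Reaches (f a) x ↔ ∃ b, G.Reaches a b ∧ f b = x := by
  constructor
  · intro h
    induction h with
    | refl => exact ⟨a, Relation.ReflTransGen.refl, rfl⟩
    | tail _ h1 ih =>
      obtain ⟨b, hb, rfl⟩ := ih
      obtain ⟨c, d, hcd, h2, rfl⟩ := mem_edges_relabel.1 h1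
      exact ⟨d, hb.tail (f.injective h2 ▸ hcd), rfl⟩
  · rintro ⟨b, hb, rfl⟩
    exact Relation.ReflTransGen.lift f (fun _ _ h => map_mem_edges_relabel.2 h) _ _ hb

theorem nonDescendants_relabel :
    (G.relabel f).nonDescendants (f v) = (G.nonDescendants v).map f := by
  ext x
  simp only [mem_nonDescendants, verts_relabel, Finset.mem_map, reaches_relabel_iff]
  constructor
  · rintro ⟨⟨u, hu, rfl⟩, h⟩
    exact ⟨u, ⟨hu, fun h1 => h ⟨u, h1, rfl⟩⟩, rfl⟩
  · rintro ⟨u, ⟨hu, h⟩, rfl⟩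
    refine ⟨⟨u, hu, rfl⟩, ?_⟩
    rintro ⟨w, hw, hwu⟩
    exact h (f.injective hwu ▸ hw)

theorem isMarkov_relabel_iff {Ω : Type} [MeasurableSpace Ω] [StandardBorelSpace Ω]
    {μ : Measure Ω} [IsProbabilityMeasure μ] {X : ℕ → Ω → ℝ} (hX : ∀ v, Measurable (X v)) :
    (G.relabel f).IsMarkov μ X hX ↔
      G.IsMarkov μ (fun u => X (f u)) (fun u => hX (f u)) := by
  rw [isMarkov_iff_ci, isMarkov_iff_ci, verts_relabel, Finset.forall_mem_map]
  refine forall₂_congr fun v _ => ?_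
  rw [nonDescendants_relabel, parents_relabel, ← Finset.map_singleton, ci_map]

theorem markovEquiv_relabel_iff :
    MarkovEquiv (G.relabel f) (K.relabel f) ↔ MarkovEquiv G K := by
  refine and_congr (Finset.map_inj) ⟨fun h Ω _ _ μ _ X hX => ?_, fun h Ω _ _ μ _ X hX => ?_⟩
  -- Variables for the original labels are transported along a left inverse of `f`; composing with
  -- `f` gives them back.
  · have h1 := h Ω μ (fun u => X (Function.invFun f u)) fun u => hX _
    rw [isMarkov_relabel_iff, isMarkov_relabel_iff] at h1
    have h2 : (fun u => X (Function.invFun f (f u))) = X := by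
      funext u
      rw [Function.leftInverse_invFun f.injective u]
    simpa only [h2] using h1
  · rw [isMarkov_relabel_iff, isMarkov_relabel_iff]
    exact h Ω μ _ _

theorem relabel_intervene : (G.intervene v).relabel f = (G.relabel f).intervene (f v) := by
  refine ext_edges rfl fun x y => ?_
  rw [mem_edges_intervene, mem_edges_relabel, mem_edges_relabel]
  constructor
  · rintro ⟨a, b, hab, rfl, rfl⟩
    obtain ⟨h1, h2⟩ := mem_edges_intervene.1 hab
    exact ⟨⟨a, b, h1, rfl, rfl⟩, fun h => h2 (f.injective h)⟩
  · rintro ⟨⟨a, b, hab, rfl, rfl⟩, h⟩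
    exact ⟨a, b, mem_edges_intervene.2 ⟨hab, fun h1 => h (h1 ▸ rfl)⟩, rfl, rfl⟩

theorem iMarkovEquiv_relabel_iff :
    IMarkovEquiv (J.map f) (G.relabel f) (K.relabel f) ↔ IMarkovEquiv J G K := by
  refine and_congr markovEquiv_relabel_iff ?_
  rw [Finset.forall_mem_map]
  refine forall₂_congr fun v _ => ?_
  rw [← relabel_intervene, ← relabel_intervene, markovEquiv_relabel_iff]

theorem exists_relabel_eq {V : Finset ℕ} (h : K.verts = V.map f) :
    ∃ H : CausalDAG, H.relabel f = K := by
  refine ⟨⟨V, (V ×ˢ V).filter fun e => (f e.1, f e.2) ∈ K.edges, Finset.filter_subset _ _,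
    fun v hv => K.acyclic (f v) (Relation.TransGen.lift f (fun a b hab => ?_) _ _ hv)⟩, ?_⟩
  · exact (Finset.mem_filter.1 hab).2
  · refine ext_edges h.symm fun x y => ?_
    rw [mem_edges_relabel]
    constructor
    · rintro ⟨a, b, hab, rfl, rfl⟩
      exact (Finset.mem_filter.1 hab).2
    · intro hxy
      have hx := left_mem_verts hxy
      have hy := right_mem_verts hxy
      rw [h, Finset.mem_map] at hx hy
      obtain ⟨a, ha, rfl⟩ := hx
      obtain ⟨b, hb, rfl⟩ := hy
      exact ⟨a, b, Finset.mem_filter.2 ⟨Finset.mem_product.2 ⟨ha, hb⟩, hxy⟩, rfl, rfl⟩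

theorem undirected_relabel :
    ((G.relabel f).essentialGraph (J.map f)).undirected =
      (G.essentialGraph J).undirected.map f.sym2Map := by
  ext e
  rw [Finset.mem_map, mem_undirected]
  constructor
  · rintro ⟨x, y, hxy, ⟨H, hH, hH'⟩, rfl⟩
    obtain ⟨a, b, hab, rfl, rfl⟩ := mem_edges_relabel.1 hxy
    obtain ⟨H, rfl⟩ := exists_relabel_eq hH.1.1.symm
    exact ⟨s(a, b), mem_undirected.2 ⟨a, b, hab, ⟨H, iMarkovEquiv_relabel_iff.1 hH,
      fun h => hH' (map_mem_edges_relabel.2 h)⟩, rfl⟩, rfl⟩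
  · rintro ⟨e, he, rfl⟩
    obtain ⟨a, b, hab, ⟨H, hH, hH'⟩, rfl⟩ := mem_undirected.1 he
    exact ⟨f a, f b, map_mem_edges_relabel.2 hab, ⟨H.relabel f, iMarkovEquiv_relabel_iff.2 hH,
      fun h => hH' (map_mem_edges_relabel.1 h)⟩, rfl⟩

theorem undirected_inter_verts :
    (G.essentialGraph (J ∩ G.verts)).undirected = (G.essentialGraph J).undirected := by
  refine undirected_congr_of_inter_core ?_
  rw [Finset.inter_assoc, Finset.inter_eq_right.2 (verts_core.trans_subset Finset.sdiff_subset)]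

theorem relabel_eq_self (h : ∀ v ∈ G.verts, f v = v) : G.relabel f = G := by
  refine ext_edges ?_ fun x y => ?_
  · ext x
    rw [verts_relabel, Finset.mem_map]
    exact ⟨fun ⟨u, hu, hux⟩ => hux ▸ (h u hu).symm ▸ hu, fun hx => ⟨x, hx, h x hx⟩⟩
  · rw [mem_edges_relabel]
    constructor
    · rintro ⟨a, b, hab, rfl, rfl⟩
      rwa [h a (left_mem_verts hab), h b (right_mem_verts hab)]
    · exact fun hxy => ⟨x, y, hxy, h x (left_mem_verts hxy), h y (right_mem_verts hxy)⟩

end Relabel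

/-! ### Deleting the last vertex of an oriented graph -/

section Orient

variable {n : ℕ}

theorem mem_edges_orient {S : SimpleGraph (Fin n)} {π : Equiv.Perm (Fin n)} {a b : ℕ} :
    (a, b) ∈ (orient S π).edges ↔
      ∃ x y : Fin n, S.Adj x y ∧ π x < π y ∧ (x : ℕ) = a ∧ (y : ℕ) = b := by
  simp [orient, and_assoc]

theorem mem_edges_orient_iff {S : SimpleGraph (Fin n)} {π : Equiv.Perm (Fin n)} {x y : Fin n} :
    ((x : ℕ), (y : ℕ)) ∈ (orient S π).edges ↔ S.Adj x y ∧ π x < π y := by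
  rw [mem_edges_orient]
  constructor
  · rintro ⟨x', y', h1, h2, h3, h4⟩
    obtain rfl := Fin.ext h3
    obtain rfl := Fin.ext h4
    exact ⟨h1, h2⟩
  · exact fun h => ⟨x, y, h.1, h.2, rfl, rfl⟩

@[simp]
theorem verts_orient (S : SimpleGraph (Fin n)) (π : Equiv.Perm (Fin n)) :
    (orient S π).verts = Finset.range n := rfl

/-- The order of `Fin (n + 1)` with last element `v` that restricts to the order `π` of the
other elements. -/
def insertLast (v : Fin (n + 1)) (π : Equiv.Perm (Fin n)) : Equiv.Perm (Fin (n + 1)) :=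
  ((finSuccEquiv' v).trans (Equiv.optionCongr π)).trans (finSuccEquiv' (Fin.last n)).symm

@[simp]
theorem insertLast_self (v : Fin (n + 1)) (π : Equiv.Perm (Fin n)) :
    insertLast v π v = Fin.last n := by
  simp [insertLast]

@[simp]
theorem insertLast_succAbove (v : Fin (n + 1)) (π : Equiv.Perm (Fin n)) (x : Fin n) :
    insertLast v π (v.succAbove x) = (π x).castSucc := by
  simp [insertLast]

theorem insertLast_bijective :
    Function.Bijective fun p : Fin (n + 1) × Equiv.Perm (Fin n) => insertLast p.1 p.2 := by
  rw [Fintype.bijective_iff_injective_and_card]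
  constructor
  · rintro ⟨v, π⟩ ⟨w, τ⟩ h
    have h : insertLast v π = insertLast w τ := h
    obtain rfl : v = w := (insertLast w τ).injective
      ((congrArg (· v) h).symm.trans ((insertLast_self v π).trans (insertLast_self w τ).symm))
    refine Prod.ext rfl (Equiv.ext fun x => Fin.castSucc_injective n ?_)
    rw [← insertLast_succAbove v, h, insertLast_succAbove]
  · simp [Fintype.card_perm, Nat.factorial_succ]

theorem insertLast_last_one : insertLast (Fin.last n) 1 = 1 := by
  ext x
  refine Fin.lastCases ?_ (fun y => ?_) x
  · simp
  · rw [← Fin.succAbove_last_apply, insertLast_succAbove]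
    simp

/-- The order embedding of `ℕ` that skips `v`. -/
def skip (v : ℕ) : ℕ ↪o ℕ :=
  OrderEmbedding.ofStrictMono (fun x => if x < v then x else x + 1) fun x y h => by
    dsimp only
    split_ifs <;> omega

theorem skip_apply (v x : ℕ) : skip v x = if x < v then x else x + 1 := rfl

theorem skip_coe (v : Fin (n + 1)) (x : Fin n) : skip v x = v.succAbove x := by
  rw [skip_apply, Fin.succAbove]
  split_ifs with h1 h2 h2
  · rfl
  · exact absurd h1 h2
  · exact absurd h2 h1
  · rfl

theorem orient_insertLast_deleteVerts (S : SimpleGraph (Fin (n + 1))) (v : Fin (n + 1))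
    (π : Equiv.Perm (Fin n)) :
    (orient S (insertLast v π)).deleteVerts {(v : ℕ)} =
      (orient (S.comap v.succAbove) π).relabel (skip v).toEmbedding := by
  refine ext_edges ?_ fun a b => ?_
  · ext a
    simp only [verts_deleteVerts, verts_orient, verts_relabel, Finset.mem_sdiff, Finset.mem_range,
      Finset.mem_singleton, Finset.mem_map]
    constructor
    · rintro ⟨h1, h2⟩
      obtain ⟨x, hx⟩ := Fin.exists_succAbove_eq (x := ⟨a, h1⟩) (y := v) 
        (fun h => h2 (congrArg Fin.val h))
      exact ⟨x, x.2, (skip_coe v x).trans (congrArg Fin.val hx)⟩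
    · rintro ⟨x, hx, rfl⟩
      have := skip_coe v ⟨x, hx⟩
      refine ⟨?_, ?_⟩
      · exact this.trans_lt (Fin.is_lt _)
      · exact fun h => Fin.succAbove_ne v ⟨x, hx⟩ (Fin.ext (this.symm.trans h))
  · rw [mem_edges_deleteVerts, mem_edges_orient, mem_edges_relabel]
    constructor
    · rintro ⟨⟨x, y, hS, hπ, rfl, rfl⟩, h1, h2⟩
      obtain ⟨x, rfl⟩ := Fin.exists_succAbove_eq (x := x) (y := v) (fun h => h1 (by simp [h]))
      obtain ⟨y, rfl⟩ := Fin.exists_succAbove_eq (x := y) (y := v) (fun h => h2 (by simp [h]))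
      rw [insertLast_succAbove, insertLast_succAbove, Fin.castSucc_lt_castSucc_iff] at hπ
      exact ⟨x, y, mem_edges_orient_iff.2 ⟨hS, hπ⟩, skip_coe v x, skip_coe v y⟩
    · rintro ⟨a, b, hab, rfl, rfl⟩
      obtain ⟨x, y, hS, hπ, rfl, rfl⟩ := mem_edges_orient.1 hab
      refine ⟨⟨v.succAbove x, v.succAbove y, hS, ?_, (skip_coe v x).symm, (skip_coe v y).symm⟩,
        fun h => ?_, fun h => ?_⟩
      · simpa using hπ
      · exact Fin.succAbove_ne v x (Fin.ext ((skip_coe v x).symm.trans (Finset.mem_singleton.1 h)))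
      · exact Fin.succAbove_ne v y (Fin.ext ((skip_coe v y).symm.trans (Finset.mem_singleton.1 h)))

/-- The graphs in which `v` has a neighbour `x` that is adjacent to all other neighbours. -/
def HasDominatingNeighbor (v : Fin n) (S : SimpleGraph (Fin n)) : Prop :=
  ∃ x, S.Adj x v ∧ ∀ y, y ≠ x → S.Adj y v → S.Adj y x

/-- The last vertex has only incoming edges, so all its neighbours are parents. A neighbour that
does not dominate has a non-adjacent second parent, which forms a v-structure. -/
theorem isShieldedSink_orient_insertLast {S : SimpleGraph (Fin (n + 1))} {v : Fin (n + 1)}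
    (π : Equiv.Perm (Fin n)) (h : ¬ HasDominatingNeighbor v S) :
    (orient S (insertLast v π)).IsShieldedSink v := by
  refine ⟨⟨Finset.mem_range.2 v.2, fun x hx => ?_⟩, fun a ha => ?_⟩
  · obtain ⟨w, z, -, h1, h2, -⟩ := mem_edges_orient.1 hx
    obtain rfl := Fin.ext h2
    rw [insertLast_self] at h1
    exact absurd h1 (Fin.le_last _).not_gt
  · obtain ⟨x, w, hS, -, rfl, h2⟩ := mem_edges_orient.1 ha
    obtain rfl := Fin.ext h2
    simp only [HasDominatingNeighbor, not_exists, not_and, not_forall] at h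
    obtain ⟨y, hyx, hyw, hn⟩ := h x hS
    refine ⟨y, mem_edges_orient_iff.2 ⟨hyw, ?_⟩, fun h => hyx (Fin.ext h.symm),
      fun h => hn (mem_edges_orient_iff.1 h).1.symm, fun h => hn (mem_edges_orient_iff.1 h).1⟩
    rw [insertLast_self, Fin.lt_last_iff_ne_last, ← insertLast_self w π]
    exact fun h => hyw.ne ((insertLast w π).injective h)

end Orient

end CausalDAG

namespace InterventionAlgorithm

open CausalDAG

variable {A : InterventionAlgorithm} {n : ℕ}

theorem LabelInvariant.undirectedCount_relabel (hA : A.LabelInvariant) (r : ℕ) (G : CausalDAG)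
    (f : ℕ ↪o ℕ) : A.undirectedCount r (G.relabel f.toEmbedding) = A.undirectedCount r G := by
  rw [undirectedCount, undirectedCount, ← undirected_inter_verts, hA, undirected_relabel,
    Finset.card_map, undirected_inter_verts]

/-- If the last vertex `v` of the order has no dominating neighbour, then it can be deleted. -/
theorem DownstreamIndependent.undirectedCount_orient (hA : A.DownstreamIndependent) (r : ℕ)
    {S : SimpleGraph (Fin (n + 1))} {v : Fin (n + 1)} (π : Equiv.Perm (Fin n))
    (h : ¬ HasDominatingNeighbor v S) :
    A.undirectedCount r (orient S (insertLast v π)) =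
      A.undirectedCount r ((orient (S.comap v.succAbove) π).relabel (skip v).toEmbedding) := by
  rw [← orient_insertLast_deleteVerts,
    hA.undirectedCount_deleteVerts r (isShieldedSink_orient_insertLast π h)]

theorem undirectedCount_le_choose (A : InterventionAlgorithm) (r : ℕ) (G : CausalDAG) :
    A.undirectedCount r G ≤ G.verts.card.choose 2 :=
  card_undirected_le

end InterventionAlgorithm

/-! ### Probability of the exceptional event -/

section Indep

variable {Ω ι κ : Type*} {mΩ : MeasurableSpace Ω} {μ : Measure Ω} [IsProbabilityMeasure μ]

/-- The events involve pairwise distinct indices, so the factors multiply. With `a`, `b k`, `c k`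
the edges `j v`, `k v`, `k j`, this is the event that `j` dominates the neighbours of `v`. -/
theorem ProbabilityTheory.iIndep.measureReal_inter_biInter_compl {m : ι → MeasurableSpace Ω}
    (hm : ∀ i, m i ≤ mΩ) (h : iIndep m μ) {C : ι → Set Ω} (hC : ∀ i, MeasurableSet[m i] (C i))
    {q : ℝ} {a : ι} {b c : κ → ι} {T : Finset κ} (ha : μ.real (C a) = q)
    (hb : ∀ k ∈ T, μ.real (C (b k)) = q) (hc : ∀ k ∈ T, μ.real (C (c k)) = q)
    (hab : ∀ k ∈ T, a ≠ b k) (hac : ∀ k ∈ T, a ≠ c k)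
    (hbb : Set.InjOn b T) (hcc : Set.InjOn c T) (hbc : ∀ k ∈ T, ∀ l ∈ T, b k ≠ c l) :
    μ.real (C a ∩ ⋂ k ∈ T, (C (b k) ∩ (C (c k))ᶜ)ᶜ) = q * (1 - q * (1 - q)) ^ T.card := by
  classical
  have hC' : ∀ i, MeasurableSet (C i) := fun i => hm i _ (hC i)
  induction T using Finset.induction_on with
  | empty => simpa using ha
  | insert k T hk ih =>
    have hsub : T ⊆ insert k T := Finset.subset_insert k T
    have ih := ih (fun l hl => hb l (hsub hl)) (fun l hl => hc l (hsub hl))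
      (fun l hl => hab l (hsub hl)) (fun l hl => hac l (hsub hl))
      (hbb.mono (by exact_mod_cast hsub)) (hcc.mono (by exact_mod_cast hsub))
      (fun l hl l' hl' => hbc l (hsub hl) l' (hsub hl'))
    have hkI : k ∈ insert k T := Finset.mem_insert_self k T
    have hne : ∀ l ∈ T, l ≠ k := fun l hl hlk => hk (hlk ▸ hl)
    -- `F` collects the indices of all factors treated so far; the new factor uses only `b k` and `c
    -- k`, which are not among them.
    set F : Set ι := {i | i = a ∨ ∃ l ∈ T, i = b l ∨ i = c l} with hF
    have hle : ∀ (s : Set ι), ∀ i ∈ s, m i ≤ ⨆ i ∈ s, m i := fun s i hi =>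
      le_iSup₂_of_le i hi le_rfl
    have hdisj : Disjoint F {b k, c k} := by
      rw [Set.disjoint_left]
      rintro i hi hik
      rcases hik with rfl | hik
      · rcases hi with h1 | ⟨l, hl, h1 | h1⟩
        · exact hab k hkI h1.symm
        · exact hne l hl (hbb (hsub hl) hkI h1.symm)
        · exact hbc k hkI l (hsub hl) h1
      · rw [Set.mem_singleton_iff] at hik
        subst hik
        rcases hi with h1 | ⟨l, hl, h1 | h1⟩
        · exact hac k hkI h1.symm
        · exact hbc l (hsub hl) k hkI h1.symm
        · exact hne l hl (hcc (hsub hl) hkI h1.symm)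
    have hind := indep_iSup_of_disjoint hm h hdisj
    have hE : MeasurableSet[⨆ i ∈ F, m i] (C a ∩ ⋂ l ∈ T, (C (b l) ∩ (C (c l))ᶜ)ᶜ) := by
      refine MeasurableSet.inter (hle F a (Or.inl rfl) _ (hC a)) ?_
      refine Finset.measurableSet_biInter T fun l hl => MeasurableSet.compl ?_
      exact MeasurableSet.inter (hle F _ (Or.inr ⟨l, hl, Or.inl rfl⟩) _ (hC _))
        (MeasurableSet.compl (hle F _ (Or.inr ⟨l, hl, Or.inr rfl⟩) _ (hC _)))
    have hB : MeasurableSet[⨆ i ∈ ({b k, c k} : Set ι), m i] (C (b k) ∩ (C (c k))ᶜ)ᶜ :=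
      MeasurableSet.compl (MeasurableSet.inter (hle _ _ (Or.inl rfl) _ (hC _))
        (MeasurableSet.compl (hle _ _ (Or.inr rfl) _ (hC _))))
    have h1 := (Indep_iff _ _ μ).1 hind _ _ hE hB
    have h2 := (Indep_iff _ _ μ).1 (h.indep (hbc k hkI k hkI)) _ _ (hC (b k)) (hC (c k)).compl
    have h3 : μ.real (C (b k) ∩ (C (c k))ᶜ) = q * (1 - q) := by
      rw [measureReal_def, h2, ENNReal.toReal_mul, ← measureReal_def, ← measureReal_def,
        probReal_compl_eq_one_sub (hC' _), hb k hkI, hc k hkI]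
    rw [Finset.set_biInter_insert, Set.inter_comm (_ᶜ), ← Set.inter_assoc, measureReal_def, h1,
      ENNReal.toReal_mul, ← measureReal_def, ← measureReal_def, ih,
      probReal_compl_eq_one_sub ((hC' _).inter (hC' _).compl), h3, Finset.card_insert_of_notMem hk,
      pow_succ, mul_assoc]

end Indep

namespace SimpleGraph

open unitInterval

variable {V W : Type*} (ρ : I)

/-- The law of the indicator of the edge `e` in the binomial random graph. -/
noncomputable def edgeMeasure (e : Sym2 V) : Measure Prop :=
  toNNReal ρ • Measure.dirac (e ∈ (Sym2.diagSetᶜ : Set (Sym2 V))) +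
    toNNReal (σ ρ) • Measure.dirac False

instance (e : Sym2 V) : IsProbabilityMeasure (edgeMeasure ρ e) := by
  unfold edgeMeasure
  infer_instance

/-- The graph whose edges are described by `p`. -/
def ofEdgePred (p : Sym2 V → Prop) : SimpleGraph V := fromEdgeSet {e | p e}

theorem ofEdgePred_adj {p : Sym2 V → Prop} {a b : V} :
    (ofEdgePred p).Adj a b ↔ p s(a, b) ∧ a ≠ b := by
  simp [ofEdgePred]

theorem measurable_ofEdgePred : Measurable (ofEdgePred : (Sym2 V → Prop) → SimpleGraph V) := by
  simp only [measurable_iff_adj, ofEdgePred_adj]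
  fun_prop

theorem binomialRandom_eq_map_infinitePi [Countable V] :
    binomialRandom V ρ = (Measure.infinitePi (edgeMeasure ρ)).map ofEdgePred := by
  rw [binomialRandom_eq_map, setBernoulli_eq_map, Measure.map_map measurable_fromEdgeSet]
  · rfl
  · exact MeasurableEquiv.setOfPred.measurable

theorem iIndepFun_edge :
    iIndepFun (fun (e : Sym2 V) (p : Sym2 V → Prop) => p e)
      (Measure.infinitePi (edgeMeasure ρ)) :=
  iIndepFun_infinitePi (X := fun _ q => q) fun _ => measurable_id

/-- An injective map on vertices is injective on edges and preserves loops, so it selects a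
subfamily of the independent edge indicators with the same marginals. This is the coupling of the
two graph sizes. -/
theorem map_comap_binomialRandom [Countable V] [Countable W] (g : V ↪ W) :
    (binomialRandom W ρ).map (fun S => S.comap g) = binomialRandom V ρ := by
  have hg : Measurable fun (p : Sym2 W → Prop) (e : Sym2 V) => p (e.map g) :=
    measurable_pi_lambda _ fun e => measurable_pi_apply _
  have hc : Measurable fun S : SimpleGraph W => S.comap g := by
    simp only [measurable_iff_adj, comap_adj]
    fun_prop
  have h1 : (Measure.infinitePi (edgeMeasure ρ)).map
      (fun (p : Sym2 W → Prop) (e : Sym2 V) => p (e.map g)) =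
      Measure.infinitePi (edgeMeasure ρ) := by
    have h2 := ((iIndepFun_edge (V := W) ρ).precomp
      (Sym2.map.injective g.injective)).map_fun_eq_infinitePi_map fun e => measurable_pi_apply _
    rw [h2]
    congr 1
    funext e
    rw [Measure.infinitePi_map_eval]
    have h3 : (e.map g ∈ (Sym2.diagSetᶜ : Set (Sym2 W))) =
        (e ∈ (Sym2.diagSetᶜ : Set (Sym2 V))) := by
      induction e with
      | _ a b => simp
    rw [edgeMeasure, edgeMeasure, h3]
  rw [binomialRandom_eq_map_infinitePi, Measure.map_map hc measurable_ofEdgePred,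
    binomialRandom_eq_map_infinitePi, ← h1, Measure.map_map measurable_ofEdgePred hg]
  congr 1
  funext p
  ext a b
  simp [ofEdgePred_adj]

theorem infinitePi_edgeMeasure_real {e : Sym2 V} (he : ¬ e.IsDiag) :
    (Measure.infinitePi (edgeMeasure ρ)).real {p | p e} = ρ := by
  have h1 : ({p | p e} : Set (Sym2 V → Prop)) = (fun p => p e) ⁻¹' {True} := by
    ext p
    simp
  rw [h1, ← map_measureReal_apply (measurable_pi_apply e) (measurableSet_singleton _),
    Measure.infinitePi_map_eval, edgeMeasure]
  simp [measureReal_def, he]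

instance [Countable V] : MeasurableSingletonClass (SimpleGraph V) := by
  refine ⟨fun S => ?_⟩
  have h1 : ({S} : Set (SimpleGraph V)) = edgeSet ⁻¹' {S.edgeSet} := by
    ext T
    simp
  rw [h1]
  exact measurable_edgeSet (measurableSet_singleton _)

theorem binomialRandom_hasDominatingNeighbor_le {n : ℕ} (v : Fin (n + 1)) :
    (binomialRandom (Fin (n + 1)) ρ).real {S | CausalDAG.HasDominatingNeighbor v S} ≤
      ρ * n * (1 - ρ * (1 - ρ)) ^ (n - 1) := by
  classical
  rw [binomialRandom_eq_map_infinitePi,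
    map_measureReal_apply measurable_ofEdgePred (Set.toFinite _).measurableSet]
  set C : Sym2 (Fin (n + 1)) → Set (Sym2 (Fin (n + 1)) → Prop) := fun e => {p | p e} with hC
  have key : ∀ j, j ≠ v → (Measure.infinitePi (edgeMeasure ρ)).real
      (C s(j, v) ∩ ⋂ k ∈ ({j, v} : Finset (Fin (n + 1)))ᶜ, (C s(k, v) ∩ (C s(k, j))ᶜ)ᶜ) =
        ρ * (1 - ρ * (1 - ρ)) ^ (n - 1) := by
    intro j hj
    -- There are `n + 1` vertices, and the `n - 1` apart from `j` and `v` each contribute a factor.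
    -- The truncated subtraction is harmless: `j ≠ v` forces `n ≥ 1`.
    have hcard : (({j, v} : Finset (Fin (n + 1)))ᶜ).card = n - 1 := by
      rw [Finset.card_compl, Finset.card_pair hj, Fintype.card_fin]
      omega
    rw [← hcard]
    have hmem : ∀ k ∈ ({j, v} : Finset (Fin (n + 1)))ᶜ, k ≠ j ∧ k ≠ v := fun k hk => by
      simpa using hk
    refine (iIndepFun_edge ρ).iIndep.measureReal_inter_biInter_compl
      (fun e => (measurable_pi_apply e).comap_le) (fun e => ⟨{True}, measurableSet_singleton _, ?_⟩)
      (infinitePi_edgeMeasure_real ρ (by simpa using hj))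
      (fun k hk => infinitePi_edgeMeasure_real ρ (by simpa using (hmem k hk).2))
      (fun k hk => infinitePi_edgeMeasure_real ρ (by simpa using (hmem k hk).1))
      (fun k hk h => ?_) (fun k hk h => ?_) (fun k hk l hl h => ?_) (fun k hk l hl h => ?_)
      (fun k hk l hl h => ?_)
    · ext p
      simp [hC]
    · have := hmem k hk
      simp only [Sym2.eq_iff] at h
      grind
    · have := hmem k hk
      simp only [Sym2.eq_iff] at h
      grind
    · have := hmem k hk
      simp only [Sym2.eq_iff] at h
      grind
    · have := hmem k hk
      simp only [Sym2.eq_iff] at h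
      grind
    · have := hmem k hk
      have := hmem l hl
      simp only [Sym2.eq_iff] at h
      grind
  calc (Measure.infinitePi (edgeMeasure ρ)).real
        (ofEdgePred ⁻¹' {S | CausalDAG.HasDominatingNeighbor v S})
      ≤ (Measure.infinitePi (edgeMeasure ρ)).real (⋃ j ∈ ({v} : Finset (Fin (n + 1)))ᶜ,
        (C s(j, v) ∩ ⋂ k ∈ ({j, v} : Finset (Fin (n + 1)))ᶜ, (C s(k, v) ∩ (C s(k, j))ᶜ)ᶜ)) := by
        refine measureReal_mono ?_ (measure_ne_top _ _)
        rintro p ⟨j, hj, h⟩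
        rw [ofEdgePred_adj] at hj
        refine Set.mem_iUnion₂.2 ⟨j, by simpa using hj.2, hj.1, Set.mem_iInter₂.2 fun k hk => ?_⟩
        simp only [Finset.mem_compl, Finset.mem_insert, Finset.mem_singleton, not_or] at hk
        rintro ⟨h1, h2⟩
        exact h2 (ofEdgePred_adj.1 (h k hk.1 (ofEdgePred_adj.2 ⟨h1, hk.2⟩))).1
    _ ≤ ∑ j ∈ ({v} : Finset (Fin (n + 1)))ᶜ, (Measure.infinitePi (edgeMeasure ρ)).real
        (C s(j, v) ∩ ⋂ k ∈ ({j, v} : Finset (Fin (n + 1)))ᶜ, (C s(k, v) ∩ (C s(k, j))ᶜ)ᶜ) :=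
        measureReal_biUnion_finset_le _ _
    _ = ∑ _j ∈ ({v} : Finset (Fin (n + 1)))ᶜ, (ρ : ℝ) * (1 - ρ * (1 - ρ)) ^ (n - 1) :=
        Finset.sum_congr rfl fun j hj => key j (by simpa using hj)
    _ = ρ * n * (1 - ρ * (1 - ρ)) ^ (n - 1) := by
        rw [Finset.sum_const, Finset.card_compl, Finset.card_singleton, Fintype.card_fin,
          Nat.add_sub_cancel, nsmul_eq_mul]
        ring

end SimpleGraph

/-! ### Comparison of the expectations -/

namespace InterventionAlgorithm

open CausalDAG SimpleGraph

variable {A : InterventionAlgorithm} {n : ℕ}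

/-- Under the coupling, the counts differ only if `v` has a dominating neighbour. The hypothesis
`hY` absorbs the renaming that closes the gap left by `v` and is the only place where the two models
differ. -/
theorem DownstreamIndependent.abs_integral_orient_sub_le (hA : A.DownstreamIndependent) (r : ℕ)
    (ρ : unitInterval) (v : Fin (n + 1)) (π : Equiv.Perm (Fin n))
    (hY : ∀ S : SimpleGraph (Fin n),
      A.undirectedCount r ((orient S π).relabel (skip v).toEmbedding) =
        A.undirectedCount r (orient S π)) :
    |(∫ S, (A.undirectedCount r (orient S (insertLast v π)) : ℝ)
          ∂(binomialRandom (Fin (n + 1)) ρ)) -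
        ∫ S, (A.undirectedCount r (orient S π) : ℝ) ∂(binomialRandom (Fin n) ρ)| ≤
      (ρ : ℝ) * n * (1 - ρ * (1 - ρ)) ^ (n - 1) * (n * (n + 1) / 2) := by
  have hchoose : ((n + 1).choose 2 : ℝ) = n * (n + 1) / 2 := by
    rw [Nat.cast_choose_two]
    push_cast
    ring
  have hle : ∀ S, |(A.undirectedCount r (orient S (insertLast v π)) : ℝ) -
      A.undirectedCount r (orient (S.comap v.succAbove) π)| ≤
        {S | HasDominatingNeighbor v S}.indicator (fun _ => (n * (n + 1) / 2 : ℝ)) S := by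
    intro S
    by_cases hS : HasDominatingNeighbor v S
    · rw [Set.indicator_of_mem (by exact hS), ← hchoose]
      have h1 : (A.undirectedCount r (orient S (insertLast v π)) : ℝ) ≤ (n + 1).choose 2 := by
        exact_mod_cast (A.undirectedCount_le_choose r _).trans_eq (by simp)
      have h2 : (A.undirectedCount r (orient (S.comap v.succAbove) π) : ℝ) ≤
          (n + 1).choose 2 := by
        exact_mod_cast (A.undirectedCount_le_choose r _).trans
          (Nat.choose_le_choose 2 (by simp))
      rw [abs_sub_le_iff]
      constructor <;> linarith [Nat.cast_nonneg (α := ℝ)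
        (A.undirectedCount r (orient S (insertLast v π))), Nat.cast_nonneg (α := ℝ)
        (A.undirectedCount r (orient (S.comap v.succAbove) π))]
    · rw [Set.indicator_of_notMem (by exact hS), hA.undirectedCount_orient r π hS, hY]
      simp
  rw [← map_comap_binomialRandom ρ v.succAboveEmb,
    integral_map Measurable.of_discrete.aemeasurable
      Measurable.of_discrete.aestronglyMeasurable,
    ← integral_sub Integrable.of_finite Integrable.of_finite]
  calc _ ≤ ∫ S, |(A.undirectedCount r (orient S (insertLast v π)) : ℝ) -
        A.undirectedCount r (orient (S.comap v.succAbove) π)| ∂(binomialRandom (Fin (n + 1)) ρ) :=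
        abs_integral_le_integral_abs
    _ ≤ ∫ S, {S | HasDominatingNeighbor v S}.indicator (fun _ => (n * (n + 1) / 2 : ℝ)) S
        ∂(binomialRandom (Fin (n + 1)) ρ) :=
        integral_mono Integrable.of_finite Integrable.of_finite hle
    _ = (binomialRandom (Fin (n + 1)) ρ).real {S | HasDominatingNeighbor v S} *
        (n * (n + 1) / 2) := by
        rw [integral_indicator_const _ (Set.toFinite _).measurableSet, smul_eq_mul]
    _ ≤ _ := by
        refine mul_le_mul_of_nonneg_right (binomialRandom_hasDominatingNeighbor_le ρ v) ?_
        positivity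

theorem integral_sortedOrderDAG (r : ℕ) (ρ : unitInterval) :
    ∫ G, (A.undirectedCount r G : ℝ) ∂(sortedOrderDAG n ρ) =
      ∫ S, (A.undirectedCount r (orient S 1) : ℝ) ∂(binomialRandom (Fin n) ρ) :=
  integral_map Measurable.of_discrete.aemeasurable (measurable_from_top).aestronglyMeasurable

theorem integral_orderDAG (r : ℕ) (ρ : unitInterval) :
    ∫ G, (A.undirectedCount r G : ℝ) ∂(orderDAG n ρ) =
      (n.factorial : ℝ)⁻¹ * ∑ π : Equiv.Perm (Fin n),
        ∫ S, (A.undirectedCount r (orient S π) : ℝ) ∂(binomialRandom (Fin n) ρ) := by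
  have hint : ∀ π : Equiv.Perm (Fin n), Integrable (fun G => (A.undirectedCount r G : ℝ))
      ((binomialRandom (Fin n) ρ).map fun S => orient S π) := fun π =>
    (integrable_map_measure measurable_from_top.aestronglyMeasurable
      Measurable.of_discrete.aemeasurable).2 Integrable.of_finite
  rw [orderDAG, integral_finsetSum_measure fun π _ => (hint π).smul_measure
    (ENNReal.inv_ne_top.2 (by exact_mod_cast n.factorial_ne_zero)), Finset.mul_sum]
  refine Finset.sum_congr rfl fun π _ => ?_
  rw [integral_smul_measure, integral_map Measurable.of_discrete.aemeasurable
    measurable_from_top.aestronglyMeasurable]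
  simp

theorem sum_perm_succ (F : Equiv.Perm (Fin (n + 1)) → ℝ) :
    ∑ π, F π = ∑ v : Fin (n + 1), ∑ π : Equiv.Perm (Fin n), F (insertLast v π) := by
  rw [← Fintype.sum_prod_type']
  exact (Function.Bijective.sum_comp insertLast_bijective F).symm

theorem DownstreamIndependent.abs_integral_sortedOrderDAG_sub_le (hA : A.DownstreamIndependent)
    (r : ℕ) (ρ : unitInterval) :
    |(∫ G, (A.undirectedCount r G : ℝ) ∂(sortedOrderDAG (n + 1) ρ)) -
        ∫ G, (A.undirectedCount r G : ℝ) ∂(sortedOrderDAG n ρ)| ≤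
      (ρ : ℝ) * n * (1 - ρ * (1 - ρ)) ^ (n - 1) * (n * (n + 1) / 2) := by
  rw [integral_sortedOrderDAG, integral_sortedOrderDAG, ← insertLast_last_one]
  refine hA.abs_integral_orient_sub_le r ρ (Fin.last n) 1 fun S => ?_
  -- In sorted form the deleted vertex has the largest label, so the renaming fixes all remaining
  -- vertices and no label invariance is needed.
  rw [relabel_eq_self]
  intro x hx
  have hx' : x < n := by simpa using hx
  simp [skip_apply, hx']

theorem DownstreamIndependent.abs_integral_orderDAG_sub_le (hA : A.DownstreamIndependent)
    (hL : A.LabelInvariant) (r : ℕ) (ρ : unitInterval) :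
    |(∫ G, (A.undirectedCount r G : ℝ) ∂(orderDAG (n + 1) ρ)) -
        ∫ G, (A.undirectedCount r G : ℝ) ∂(orderDAG n ρ)| ≤
      (ρ : ℝ) * n * (1 - ρ * (1 - ρ)) ^ (n - 1) * (n * (n + 1) / 2) := by
  rw [integral_orderDAG, integral_orderDAG, sum_perm_succ]
  set B : ℝ := (ρ : ℝ) * n * (1 - ρ * (1 - ρ)) ^ (n - 1) * (n * (n + 1) / 2)
  set f : Fin (n + 1) → Equiv.Perm (Fin n) → ℝ := fun v π =>
    ∫ S, (A.undirectedCount r (orient S (insertLast v π)) : ℝ) ∂(binomialRandom (Fin (n + 1)) ρ)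
  set g : Equiv.Perm (Fin n) → ℝ := fun π =>
    ∫ S, (A.undirectedCount r (orient S π) : ℝ) ∂(binomialRandom (Fin n) ρ)
  have hfg : ∀ v π, |f v π - g π| ≤ B := fun v π =>
    hA.abs_integral_orient_sub_le r ρ v π fun S => hL.undirectedCount_relabel r _ _
  have hfact : (0 : ℝ) < (n.factorial : ℝ) := by exact_mod_cast n.factorial_pos
  have hn : (0 : ℝ) < (n + 1 : ℝ) := by positivity
  -- A uniform order of `n + 1` vertices is a uniform last vertex with an independent uniform order
  -- of the rest, so each `g π` is counted `n + 1` times and the bound for fixed `v` and `π` can be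
  -- averaged.
  have h1 : ((n + 1).factorial : ℝ)⁻¹ * ∑ v, ∑ π, f v π - (n.factorial : ℝ)⁻¹ * ∑ π, g π =
      ((n + 1).factorial : ℝ)⁻¹ * ∑ v, ∑ π, (f v π - g π) := by
    simp only [Finset.sum_sub_distrib, Finset.sum_const, Finset.card_univ, Fintype.card_fin,
      nsmul_eq_mul, Nat.factorial_succ]
    push_cast
    field_simp
  rw [h1, abs_mul, abs_of_nonneg (by positivity), inv_mul_le_iff₀ (by positivity)]
  calc |∑ v, ∑ π, (f v π - g π)| ≤ ∑ v, ∑ π, |f v π - g π| :=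
        (Finset.abs_sum_le_sum_abs _ _).trans
          (Finset.sum_le_sum fun v _ => Finset.abs_sum_le_sum_abs _ _)
    _ ≤ ∑ _v : Fin (n + 1), ∑ _π : Equiv.Perm (Fin n), B :=
        Finset.sum_le_sum fun v _ => Finset.sum_le_sum fun π _ => hfg v π
    _ = ((n + 1).factorial : ℝ) * B := by
        simp only [Finset.sum_const, Finset.card_univ, Fintype.card_fin, Fintype.card_perm,
          nsmul_eq_mul, Nat.factorial_succ]
        push_cast
        ring

end InterventionAlgorithm

theorem mainTheorem3 (A : InterventionAlgorithm) (hA : A.DownstreamIndependent)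
    (ρ : unitInterval) (r i : ℕ) :
    |(∫ G, (A.undirectedCount r G : ℝ) ∂(CausalDAG.sortedOrderDAG (i + 1) ρ)) -
        ∫ G, (A.undirectedCount r G : ℝ) ∂(CausalDAG.sortedOrderDAG i ρ)| ≤
      (ρ : ℝ) * i * (1 - ρ * (1 - ρ)) ^ (i - 1) * (i * (i + 1) / 2) ∧
    (A.LabelInvariant →
      |(∫ G, (A.undirectedCount r G : ℝ) ∂(CausalDAG.orderDAG (i + 1) ρ)) -
          ∫ G, (A.undirectedCount r G : ℝ) ∂(CausalDAG.orderDAG i ρ)| ≤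
        (ρ : ℝ) * i * (1 - ρ * (1 - ρ)) ^ (i - 1) * (i * (i + 1) / 2)) :=
  ⟨hA.abs_integral_sortedOrderDAG_sub_le r ρ,
    fun hL => hA.abs_integral_orderDAG_sub_le hL r ρ⟩
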